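/- Let $n\ge 1$ be an integer, let $\mathbf B=\{z\in\mathbb C^n:|z|<1\}$, and let $H^2_n$ be the Drury–Arveson space, i.e. the Hilbert space of (analytic) functions on $\mathbf B$ with reproducing kernel $K_z(\zeta)=\dfrac{1}{1-\langle\zeta,z\rangle}$, where $\langle\zeta,z\rangle=\sum_{i=1}^n\zeta_i\overline{z_i}$. A function $f\in H^2_n$ is called a multiplier of $H^2_n$ if $fh\in H^2_n$ for every $h\in H^2_n$. Let $f$ be a multiplier of $H^2_n$. (0) If $f$ does not vanish on $\mathbf B$, then $f$ has an analytic logarithm: there is an analytic function $g$ on $\mathbf B$ with $e^{g}=f$. Any such $g$ may serve as $\log f$ below, and $f^t:=e^{tg}$ for $t\in\mathbb R$. (1) If there is a $c>0$ such that $|f(z)|\ge c$ for every $z\in\mathbf B$, then for every $t\in\mathbb R$ and every choice of $\log f$ the function $f^t=e^{t\log f}$ is a multiplier of $H^2_n$. (2) If $f$ does not vanish on $\mathbf B$, then for every choice of $\log f$, the function $\log f$ is a multiplier of $H^2_n$ if and only if $\log f$ is bounded on $\mathbf B$. -/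

import Mathlib

/-- The Drury-Arveson kernel `K_z(ζ) = 1 / (1 - ⟨ζ, z⟩)` on the open unit ball of `ℂⁿ`, as a matrix
with row index `ζ` and column index `z`, whose entries act on `ℂ` by multiplication.
Here `⟨ζ, z⟩ = ∑ i, ζ i * conj (z i)`, which is Mathlib's `inner ℂ z ζ`. -/
noncomputable def druryArvesonKernel (n : ℕ) :
    Matrix (Metric.ball (0 : EuclideanSpace ℂ (Fin n)) 1)
      (Metric.ball (0 : EuclideanSpace ℂ (Fin n)) 1) (ℂ →L[ℂ] ℂ) :=
  Matrix.of fun ζ z =>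
    (1 / (1 - inner ℂ (z : EuclideanSpace ℂ (Fin n)) (ζ : EuclideanSpace ℂ (Fin n)))) •
      ContinuousLinearMap.id ℂ ℂ

open scoped ComplexOrder in
/-- Powers of a Gram matrix are positive semidefinite, stated for the quadratic form. -/
theorem druryArveson_pow_nonneg {E : Type*} [NormedAddCommGroup E] [InnerProductSpace ℂ E]
    {X : Type*} (e : X → E) (k : ℕ) (s : Finset X) (v : X → ℂ) :
    0 ≤ (∑ x ∈ s, ∑ y ∈ s, v x * star (v y) * (inner ℂ (e x) (e y)) ^ k).re := by
  have key : ∀ k : ℕ, (Matrix.of fun x y : s => (inner ℂ (e x) (e y)) ^ k).PosSemidef := by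
    intro k
    induction k with
    | zero =>
      have h := Matrix.posSemidef_vecMulVec_self_star (fun _ : s => (1 : ℂ))
      convert h using 1
      ext i j
      simp [Matrix.vecMulVec]
    | succ k ih =>
      have h : (Matrix.of fun x y : s => (inner ℂ (e x) (e y)) ^ (k + 1)) =
          (Matrix.of fun x y : s => (inner ℂ (e x) (e y)) ^ k).hadamard
            (Matrix.gram ℂ (fun x : s => e x)) := by
        ext i j
        simp [Matrix.gram, pow_succ]
      rw [h]
      exact ih.hadamard (Matrix.posSemidef_gram ℂ (fun x : s => e x))
  have h := (key k).re_dotProduct_nonneg (fun x : s => star (v x))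
  have h2 : (star (fun x : s => star (v x)) ⬝ᵥ
      (Matrix.of fun x y : s => (inner ℂ (e x) (e y)) ^ k).mulVec (fun x : s => star (v x))) =
      ∑ x ∈ s, ∑ y ∈ s, v x * star (v y) * (inner ℂ (e x) (e y)) ^ k := by
    simp only [dotProduct, Matrix.mulVec, Finset.mul_sum, Matrix.of_apply, Pi.star_apply, star_star]
    rw [← Finset.sum_coe_sort s]
    refine Finset.sum_congr rfl fun x _ => ?_
    rw [← Finset.sum_coe_sort s]
    refine Finset.sum_congr rfl fun y _ => ?_
    ring
  rw [h2] at h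
  exact h

theorem druryArvesonKernel_posSemidef (n : ℕ) : (druryArvesonKernel n).PosSemidef := by
  have htfae := (RKHS.posSemidef_tfae (K := druryArvesonKernel n)).out 0 2
  refine htfae.mpr ⟨?_, fun v => ?_⟩
  · ext x y
    have h1 : star (druryArvesonKernel n y x) = druryArvesonKernel n x y := by
      simp [druryArvesonKernel, star_smul]
      rw [show ContinuousLinearMap.id ℂ ℂ = 1 from rfl, star_one]
    rw [Matrix.conjTranspose_apply, h1]
  · have hlt : ∀ x y : Metric.ball (0 : EuclideanSpace ℂ (Fin n)) 1,
        ‖inner ℂ (x : EuclideanSpace ℂ (Fin n)) (y : EuclideanSpace ℂ (Fin n))‖ < 1 := by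
      intro x y
      have hx := mem_ball_zero_iff.mp x.2
      have hy := mem_ball_zero_iff.mp y.2
      have := norm_inner_le_norm (𝕜 := ℂ) (x : EuclideanSpace ℂ (Fin n)) y
      nlinarith [norm_nonneg (x : EuclideanSpace ℂ (Fin n)),
        norm_nonneg (y : EuclideanSpace ℂ (Fin n))]
    have hs : HasSum (fun k : ℕ => (∑ x ∈ v.support, ∑ y ∈ v.support,
        v x * star (v y) * (inner ℂ (x : EuclideanSpace ℂ (Fin n)) (y : EuclideanSpace ℂ (Fin n))) ^ k).re)
        (∑ x ∈ v.support, ∑ y ∈ v.support, v x * star (v y) *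
          (1 - inner ℂ (x : EuclideanSpace ℂ (Fin n)) (y : EuclideanSpace ℂ (Fin n)))⁻¹).re := by
      refine Complex.hasSum_re (hasSum_sum fun x _ => hasSum_sum fun y _ => ?_)
      exact (hasSum_geometric_of_norm_lt_one (hlt x y)).mul_left _
    have h0 := hs.nonneg fun k => druryArveson_pow_nonneg
      (fun x : Metric.ball (0 : EuclideanSpace ℂ (Fin n)) 1 => (x : EuclideanSpace ℂ (Fin n)))
      k v.support v
    rw [Finset.sum_comm] at h0
    refine h0.trans_eq (congrArg Complex.re ?_)
    refine Finset.sum_congr rfl fun x _ => ?_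
    refine Finset.sum_congr rfl fun y _ => ?_
    simp [druryArvesonKernel]
    ring

instance druryArvesonKernel.fact_posSemidef (n : ℕ) : Fact (druryArvesonKernel n).PosSemidef :=
  ⟨druryArvesonKernel_posSemidef n⟩

/-- The Drury-Arveson space `H²ₙ`: the Hilbert space of functions on the open unit ball of `ℂⁿ`
whose reproducing kernel is the Drury-Arveson kernel. -/
abbrev DruryArveson (n : ℕ) : Type :=
  RKHS.OfKernel (druryArvesonKernel n)

/-- The function `f`, restricted to the open unit ball, belongs to `H²ₙ`.
The values of `f` outside the ball play no role. -/
def MemDruryArveson (n : ℕ) (f : EuclideanSpace ℂ (Fin n) → ℂ) : Prop :=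
  ∃ F : DruryArveson n, ∀ z : Metric.ball (0 : EuclideanSpace ℂ (Fin n)) 1, F z = f z

/-- `f` is a multiplier of `H²ₙ`: `f ∈ H²ₙ`, and `f h ∈ H²ₙ` for every `h ∈ H²ₙ`. -/
def IsDruryArvesonMultiplier (n : ℕ) (f : EuclideanSpace ℂ (Fin n) → ℂ) : Prop :=
  MemDruryArveson n f ∧
    ∀ h : EuclideanSpace ℂ (Fin n) → ℂ, MemDruryArveson n h →
      MemDruryArveson n (fun z => f z * h z)

/-- `g` is an analytic logarithm of `f` on the open unit ball of `ℂⁿ`. -/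
def IsAnalyticLog (n : ℕ) (f g : EuclideanSpace ℂ (Fin n) → ℂ) : Prop :=
  AnalyticOnNhd ℂ g (Metric.ball 0 1) ∧
    ∀ z ∈ Metric.ball (0 : EuclideanSpace ℂ (Fin n)) 1, Complex.exp (g z) = f z

/-! Let H_d be the Hilbert space on the ball with kernel (1 - ⟨ζ, z⟩)^(-(d+1)). Then H_0 is the
Drury–Arveson space, while H_n is a Bergman space: up to a constant its norm is an L² norm for
Lebesgue measure, so every bounded analytic function multiplies it
(`isWeightedMultiplier_of_bounded`). Multipliers pass up the scale by the Schur product theorem,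
since the kernel of H_(d+1) is that of H_d times that of H_0 (`IsWeightedMultiplier.succ`). The
radial derivative R links the spaces: an analytic F lies in H_d exactly when R F lies in H_(d+2)
(`MemWeighted.radialDeriv`, `memWeighted_of_radialDeriv`), because R multiplies the part of degree m
by m and the squared weights of the two spaces differ by a factor of order m².

This allows a descent by two. Suppose R b = b' · R f and F ∈ H_d. Then R(bF) = b'(R f)F + b R F, and
(R f)F = R(fF) - f R F lies in H_(d+2) because f is a multiplier. So b multiplies H_d once b and b'
multiply H_(d+2) (`isWeightedMultiplier_of_radialDeriv_eq`). For b = f^t take b' = t f^(t-1); for b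
= log f take b' = f^(-1). Boundedness settles every d ≥ n, and finitely many descents reach d = 0.

Conversely a multiplier is bounded, since kernel functions are eigenvectors of the adjoint. The
logarithm itself comes from the Poincaré lemma applied to df/f. -/

/-! ### Feature maps, multipliers and positive semidefinite kernels -/

section FeatureMaps

open Finsupp ComplexConjugate

open scoped InnerProductSpace

variable {X E E' : Type*} [NormedAddCommGroup E] [InnerProductSpace ℂ E]
  [NormedAddCommGroup E'] [InnerProductSpace ℂ E']

theorem inner_linearCombination_right (u : E) (e : X → E) (c : X →₀ ℂ) :
    ⟪u, linearCombination ℂ e c⟫_ℂ = linearCombination ℂ (fun x => ⟪u, e x⟫_ℂ) c := by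
  simp [linearCombination_apply, Finsupp.inner_sum, inner_smul_right]

theorem inner_linearCombination_self (e : X → E) (c : X →₀ ℂ) :
    (c.sum fun i xi => c.sum fun j xj => star xi * ⟪e i, e j⟫_ℂ * xj) =
      ((‖linearCombination ℂ e c‖ ^ 2 : ℝ) : ℂ) := by
  have h := inner_self_eq_norm_sq_to_K (𝕜 := ℂ) (linearCombination ℂ e c)
  have h2 : ((‖linearCombination ℂ e c‖ ^ 2 : ℝ) : ℂ) =
      (↑‖linearCombination ℂ e c‖ : ℂ) ^ 2 := by push_cast; rfl
  rw [h2]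
  refine Eq.trans ?_ h
  simp only [linearCombination_apply, Finsupp.sum, sum_inner, inner_sum, inner_smul_left,
    inner_smul_right, Finset.mul_sum]
  rw [Finset.sum_comm]
  refine Finset.sum_congr rfl fun i _ => Finset.sum_congr rfl fun j _ => ?_
  simp only [RCLike.star_def]
  ring

/-- A linear functional dominated by the norm of a feature map is represented by a vector. -/
theorem exists_eq_inner_of_bound [CompleteSpace E] (e : X → E) (F : X → ℂ) (C : ℝ)
    (h : ∀ c : X →₀ ℂ, ‖linearCombination ℂ (fun x => conj (F x)) c‖ ≤
      C * ‖linearCombination ℂ e c‖) :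
    ∃ u : E, ∀ x, F x = ⟪e x, u⟫_ℂ := by
  set T : (X →₀ ℂ) →ₗ[ℂ] E := linearCombination ℂ e with hT
  set l : (X →₀ ℂ) →ₗ[ℂ] ℂ := linearCombination ℂ (fun x => conj (F x)) with hl
  -- The bound makes `l` vanish on the kernel of `T`, so `l` descends to the span of the features.
  -- The section `s` is only linear; continuity on the span again comes from the bound. Hahn–Banach
  -- and Riesz then give the vector.
  have hker : ∀ c, T c = 0 → l c = 0 := fun c hc => by
    have := h c
    rw [hc, norm_zero, mul_zero] at this
    simpa using this
  obtain ⟨s, hs⟩ := (T.rangeRestrict).exists_rightInverse_of_surjective T.range_rangeRestrict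
  have hs' : ∀ y : LinearMap.range T, T (s y) = y := fun y => by
    have := LinearMap.congr_fun hs y
    simpa using congrArg Subtype.val this
  let g : LinearMap.range T →L[ℂ] ℂ := LinearMap.mkContinuous (l ∘ₗ s) C fun y => by
    have := h (s y)
    rw [hs' y] at this
    exact this
  obtain ⟨G, hG, -⟩ := exists_extension_norm_eq _ g
  refine ⟨(InnerProductSpace.toDual ℂ E).symm G, fun x => ?_⟩
  have h1 : G (e x) = conj (F x) := by
    have hx : T (Finsupp.single x 1) = e x := by simp [hT]
    have h2 := hG ⟨T (Finsupp.single x 1), LinearMap.mem_range_self _ _⟩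
    have h4 := hker (s ⟨T (Finsupp.single x 1), LinearMap.mem_range_self _ _⟩ - Finsupp.single x 1)
      (by rw [map_sub, hs', sub_self])
    rw [map_sub, sub_eq_zero] at h4
    rw [← hx, h2]
    change l (s ⟨T (Finsupp.single x 1), LinearMap.mem_range_self _ _⟩) = _
    rw [h4]
    simp [hl]
  rw [← inner_conj_symm, InnerProductSpace.toDual_symm_apply, h1, Complex.conj_conj]

theorem norm_linearCombination_inner_le (e : X → E) (u : E) (c : X →₀ ℂ) :
    ‖linearCombination ℂ (fun x => conj ⟪e x, u⟫_ℂ) c‖ ≤ ‖u‖ * ‖linearCombination ℂ e c‖ := by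
  have h : linearCombination ℂ (fun x => conj ⟪e x, u⟫_ℂ) c = ⟪u, linearCombination ℂ e c⟫_ℂ := by
    rw [inner_linearCombination_right]
    simp
  rw [h]
  exact norm_inner_le_norm _ _

/-- The adjoint of multiplication by `φ` is bounded from the span of the features `e'` to the span
of the features `e`. -/
def FeatureMulBound (φ : X → ℂ) (e : X → E) (e' : X → E') : Prop :=
  ∃ C : ℝ, ∀ c : X →₀ ℂ, ‖linearCombination ℂ (fun x => conj (φ x) • e x) c‖ ≤
    C * ‖linearCombination ℂ e' c‖

/-- Composing the bounded adjoint with the functional given by `u` yields a functional dominated by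
`‖u‖ * C`; the vector representing it is the product of `φ` with the function of `u`. -/
theorem FeatureMulBound.exists_mul_eq_inner [CompleteSpace E'] {φ : X → ℂ} {e : X → E}
    {e' : X → E'} (h : FeatureMulBound φ e e') (u : E) :
    ∃ v : E', ∀ x, φ x * ⟪e x, u⟫_ℂ = ⟪e' x, v⟫_ℂ := by
  obtain ⟨C, hC⟩ := h
  refine exists_eq_inner_of_bound e' _ (‖u‖ * C) fun c => ?_
  have h1 := norm_linearCombination_inner_le (fun x => conj (φ x) • e x) u c
  simp only [inner_smul_left, Complex.conj_conj] at h1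
  refine h1.trans ?_
  rw [mul_assoc]
  exact mul_le_mul_of_nonneg_left (hC c) (norm_nonneg _)

/-- A multiplier between spaces given by feature maps is bounded (uniform boundedness). -/
theorem featureMulBound_of_forall [CompleteSpace E] {φ : X → ℂ} {e : X → E} {e' : X → E'}
    (h : ∀ u : E, ∃ v : E', ∀ x, φ x * ⟪e x, u⟫_ℂ = ⟪e' x, v⟫_ℂ) : FeatureMulBound φ e e' := by
  -- Banach–Steinhaus is applied to the images, under the formal adjoint, of the combinations of
  -- norm at most one. Each `u` is bounded on this family by the norm of its product vector `v`.
  let S := {c : X →₀ ℂ // ‖linearCombination ℂ e' c‖ ≤ 1}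
  let g : S → E →L[ℂ] ℂ := fun c =>
    innerSL ℂ (linearCombination ℂ (fun x => conj (φ x) • e x) c.1)
  have hpt : ∀ u v, (∀ x, φ x * ⟪e x, u⟫_ℂ = ⟪e' x, v⟫_ℂ) → ∀ c : X →₀ ℂ,
      ‖⟪linearCombination ℂ (fun x => conj (φ x) • e x) c, u⟫_ℂ‖ ≤
        ‖v‖ * ‖linearCombination ℂ e' c‖ := by
    intro u v hv c
    rw [← inner_conj_symm, RCLike.norm_conj, inner_linearCombination_right]
    have h1 := norm_linearCombination_inner_le e' v c
    refine le_trans (le_of_eq ?_) h1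
    congr 3
    funext x
    rw [← hv x, inner_smul_right, map_mul, inner_conj_symm]
  have hb : ∀ u : E, ∃ B, ∀ c : S, ‖g c u‖ ≤ B := by
    intro u
    obtain ⟨v, hv⟩ := h u
    refine ⟨‖v‖, fun c => (hpt u v hv c.1).trans ?_⟩
    exact mul_le_of_le_one_right (norm_nonneg _) c.2
  obtain ⟨B, hB⟩ := banach_steinhaus hb
  have hB' : ∀ c : X →₀ ℂ, ‖linearCombination ℂ e' c‖ ≤ 1 →
      ‖linearCombination ℂ (fun x => conj (φ x) • e x) c‖ ≤ B := fun c hc => by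
    have := hB ⟨c, hc⟩
    simpa [g] using this
  refine ⟨B, fun c => ?_⟩
  set w := linearCombination ℂ (fun x => conj (φ x) • e x) c with hw
  -- A combination of norm zero cannot be normalised; testing against `u = w` itself shows that `w =
  -- 0`.
  rcases eq_or_ne (linearCombination ℂ e' c) 0 with h0 | h0
  · obtain ⟨v, hv⟩ := h w
    have := hpt w v hv c
    rw [h0, norm_zero, mul_zero, ← hw, norm_le_zero_iff, inner_self_eq_zero] at this
    rw [this, h0]
    simp
  · have hpos : 0 < ‖linearCombination ℂ e' c‖ := norm_pos_iff.mpr h0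
    have := hB' (((‖linearCombination ℂ e' c‖⁻¹ : ℝ) : ℂ) • c) (by
      rw [map_smul, norm_smul, Complex.norm_real, norm_inv, norm_norm,
        inv_mul_cancel₀ hpos.ne'])
    rw [map_smul, norm_smul, Complex.norm_real, norm_inv, norm_norm, ← hw,
      inv_mul_le_iff₀ hpos] at this
    rw [mul_comm]
    exact this

open scoped ComplexOrder in
theorem posSemidef_gram_feature (e : X → E) :
    (Matrix.of fun x y => ⟪e x, e y⟫_ℂ : Matrix X X ℂ).PosSemidef := by
  refine ⟨?_, fun c => ?_⟩
  · ext x y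
    simp
  · simp only [Matrix.of_apply]
    rw [inner_linearCombination_self]
    exact Complex.zero_le_real.mpr (sq_nonneg _)

-- The quadratic form of this matrix is C‖∑ c e'‖² - ‖∑ c φ̄ e‖². In this form the multiplier
-- property depends on kernels alone, and Schur products can act on it.
open scoped ComplexOrder in
theorem featureMulBound_iff {φ : X → ℂ} {e : X → E} {e' : X → E'} :
    FeatureMulBound φ e e' ↔ ∃ C : ℝ, (Matrix.of fun x y =>
      (C : ℂ) * ⟪e' x, e' y⟫_ℂ - φ x * conj (φ y) * ⟪e x, e y⟫_ℂ : Matrix X X ℂ).PosSemidef := by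
  have key : ∀ (C : ℝ) (c : X →₀ ℂ),
      (c.sum fun i xi => c.sum fun j xj => star xi *
        ((C : ℂ) * ⟪e' i, e' j⟫_ℂ - φ i * conj (φ j) * ⟪e i, e j⟫_ℂ) * xj) =
      ((C * ‖linearCombination ℂ e' c‖ ^ 2 -
        ‖linearCombination ℂ (fun x => conj (φ x) • e x) c‖ ^ 2 : ℝ) : ℂ) := by
    intro C c
    have h1 := inner_linearCombination_self e' c
    have h2 := inner_linearCombination_self (fun x => conj (φ x) • e x) c
    rw [Complex.ofReal_sub, Complex.ofReal_mul, ← h1, ← h2]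
    simp only [Finsupp.sum, Finset.mul_sum, ← Finset.sum_sub_distrib]
    refine Finset.sum_congr rfl fun i _ => Finset.sum_congr rfl fun j _ => ?_
    simp only [inner_smul_left, inner_smul_right, Complex.conj_conj]
    ring
  constructor
  · rintro ⟨C, hC⟩
    refine ⟨C ^ 2, ?_, fun c => ?_⟩
    · ext x y
      simp [mul_comm (φ y)]
    · simp only [Matrix.of_apply]
      rw [key]
      have := pow_le_pow_left₀ (norm_nonneg _) (hC c) 2
      have h3 : 0 ≤ C ^ 2 * ‖linearCombination ℂ e' c‖ ^ 2 -
        ‖linearCombination ℂ (fun x => conj (φ x) • e x) c‖ ^ 2 := by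
        rw [mul_pow] at this
        linarith
      exact_mod_cast h3
  · rintro ⟨C, -, hC⟩
    -- Nothing forces `C` to be nonnegative, hence the absolute value.
    refine ⟨√|C|, fun c => ?_⟩
    have h1 := hC c
    simp only [Matrix.of_apply] at h1
    rw [key] at h1
    have h2 : 0 ≤ C * ‖linearCombination ℂ e' c‖ ^ 2 -
        ‖linearCombination ℂ (fun x => conj (φ x) • e x) c‖ ^ 2 := by exact_mod_cast h1
    refine abs_le_of_sq_le_sq' ?_ (by positivity) |>.2
    rw [mul_pow, Real.sq_sqrt (abs_nonneg _)]
    nlinarith [le_abs_self C, sq_nonneg ‖linearCombination ℂ e' c‖]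

end FeatureMaps

/-! ### The scale of weighted spaces and their multipliers -/

section WeightedSpaces

open Finsupp ComplexConjugate

open scoped InnerProductSpace

/-- The vector of all conjugated monomials `conj (∏ i, z (w i))`, indexed by words `w` of length
`m`. -/
noncomputable def wordPower {n : ℕ} (m : ℕ) (z : EuclideanSpace ℂ (Fin n)) :
    EuclideanSpace ℂ (Fin m → Fin n) :=
  WithLp.toLp 2 fun w => conj (∏ i, z (w i))

/-- Expanding the m-th power of the sum over coordinates yields one term per word: the vector is a
tensor power of the conjugate of z. Words avoid multinomial coefficients. -/
theorem inner_wordPower {n m : ℕ} (x y : EuclideanSpace ℂ (Fin n)) :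
    ⟪wordPower m x, wordPower m y⟫_ℂ = ⟪y, x⟫_ℂ ^ m := by
  simp only [wordPower, PiLp.inner_apply, RCLike.inner_apply, Complex.conj_conj]
  rw [Fintype.sum_pow]
  refine Finset.sum_congr rfl fun w _ => ?_
  rw [map_prod, ← Finset.prod_mul_distrib]
  exact Finset.prod_congr rfl fun i _ => mul_comm _ _

theorem norm_wordPower {n m : ℕ} (z : EuclideanSpace ℂ (Fin n)) :
    ‖wordPower m z‖ = ‖z‖ ^ m := by
  have h1 := inner_self_eq_norm_sq_to_K (𝕜 := ℂ) (wordPower m z)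
  rw [inner_wordPower, inner_self_eq_norm_sq_to_K] at h1
  have h2 : (‖z‖ ^ m) ^ 2 = ‖wordPower m z‖ ^ 2 := by
    have : (((‖z‖ ^ m) ^ 2 : ℝ) : ℂ) = ((‖wordPower m z‖ ^ 2 : ℝ) : ℂ) := by
      push_cast
      rw [← pow_mul, mul_comm m, pow_mul]
      exact h1
    exact_mod_cast this
  exact ((sq_eq_sq₀ (by positivity) (norm_nonneg _)).mp h2).symm

theorem inner_wordPower_smul {n m : ℕ} (a : ℂ) (z : EuclideanSpace ℂ (Fin n))
    (u : EuclideanSpace ℂ (Fin m → Fin n)) :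
    ⟪wordPower m (a • z), u⟫_ℂ = a ^ m * ⟪wordPower m z, u⟫_ℂ := by
  simp only [wordPower, PiLp.inner_apply, RCLike.inner_apply, Complex.conj_conj, PiLp.smul_apply,
    smul_eq_mul, Finset.prod_mul_distrib, Finset.prod_const, Finset.card_univ, Fintype.card_fin,
    Finset.mul_sum]
  exact Finset.sum_congr rfl fun w _ => by ring

/-- The Hilbert space of square summable sequences of coefficients indexed by words. -/
abbrev WordSpace (n : ℕ) : Type :=
  lp (fun m : ℕ => EuclideanSpace ℂ (Fin m → Fin n)) 2

theorem memℓp_two_word {n : ℕ} {u : ∀ m : ℕ, EuclideanSpace ℂ (Fin m → Fin n)} :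
    Memℓp u 2 ↔ Summable fun m => ‖u m‖ ^ 2 := by
  rw [memℓp_gen_iff (by norm_num)]
  simp

/-- The feature map of the kernel `(1 - ⟨ζ, z⟩) ^ (-(d + 1))`. -/
noncomputable def wordFeature (n d : ℕ) (z : Metric.ball (0 : EuclideanSpace ℂ (Fin n)) 1) :
    WordSpace n :=
  ⟨fun m => ((√((m + d).choose d : ℝ) : ℝ) : ℂ) • wordPower m (z : EuclideanSpace ℂ (Fin n)), by
    change Memℓp _ 2
    rw [memℓp_two_word]
    have hz : ‖z.1‖ < 1 := mem_ball_zero_iff.mp z.2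
    have h1 : ‖(‖z.1‖ ^ 2)‖ < 1 := by
      rw [Real.norm_of_nonneg (by positivity)]
      exact pow_lt_one₀ (norm_nonneg _) hz two_ne_zero
    refine (hasSum_choose_mul_geometric_of_norm_lt_one d h1).summable.congr fun m => ?_
    rw [norm_smul, mul_pow, Complex.norm_real, Real.norm_of_nonneg (Real.sqrt_nonneg _),
      Real.sq_sqrt (Nat.cast_nonneg _), norm_wordPower, ← pow_mul, ← pow_mul, mul_comm m]⟩

theorem wordFeature_apply {n d : ℕ} (z : Metric.ball (0 : EuclideanSpace ℂ (Fin n)) 1) (m : ℕ) :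
    wordFeature n d z m =
      ((√((m + d).choose d : ℝ) : ℝ) : ℂ) • wordPower m (z : EuclideanSpace ℂ (Fin n)) :=
  rfl

theorem norm_inner_lt_one_of_ball {n : ℕ} (x y : Metric.ball (0 : EuclideanSpace ℂ (Fin n)) 1) :
    ‖⟪(x : EuclideanSpace ℂ (Fin n)), y⟫_ℂ‖ < 1 := by
  have hx := mem_ball_zero_iff.mp x.2
  have hy := mem_ball_zero_iff.mp y.2
  have := norm_inner_le_norm (𝕜 := ℂ) (x : EuclideanSpace ℂ (Fin n)) y
  nlinarith [norm_nonneg (x : EuclideanSpace ℂ (Fin n)),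
    norm_nonneg (y : EuclideanSpace ℂ (Fin n))]

theorem inner_wordFeature {n d : ℕ} (x y : Metric.ball (0 : EuclideanSpace ℂ (Fin n)) 1) :
    ⟪wordFeature n d x, wordFeature n d y⟫_ℂ =
      1 / (1 - ⟪(y : EuclideanSpace ℂ (Fin n)), x⟫_ℂ) ^ (d + 1) := by
  refine (lp.hasSum_inner _ _).unique ?_
  convert hasSum_choose_mul_geometric_of_norm_lt_one d (norm_inner_lt_one_of_ball y x) using 2
    with m
  rw [wordFeature_apply, wordFeature_apply, inner_smul_left, inner_smul_right, inner_wordPower,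
    Complex.conj_ofReal, ← mul_assoc, ← Complex.ofReal_mul,
    Real.mul_self_sqrt (Nat.cast_nonneg _)]
  simp

/-- The function `F`, restricted to the unit ball, belongs to the Hilbert space with kernel
`(1 - ⟨ζ, z⟩) ^ (-(d + 1))`. -/
def MemWeighted (n d : ℕ) (F : EuclideanSpace ℂ (Fin n) → ℂ) : Prop :=
  ∃ u : WordSpace n, ∀ z : Metric.ball (0 : EuclideanSpace ℂ (Fin n)) 1,
    F z = ⟪wordFeature n d z, u⟫_ℂ

/-- The function `φ` multiplies the space with kernel `(1 - ⟨ζ, z⟩) ^ (-(d + 1))` into itself. -/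
def IsWeightedMultiplier (n d : ℕ) (φ : EuclideanSpace ℂ (Fin n) → ℂ) : Prop :=
  ∀ F, MemWeighted n d F → MemWeighted n d (fun z => φ z * F z)

theorem MemWeighted.congr {n d : ℕ} {F G : EuclideanSpace ℂ (Fin n) → ℂ} (hF : MemWeighted n d F)
    (h : ∀ z ∈ Metric.ball (0 : EuclideanSpace ℂ (Fin n)) 1, F z = G z) : MemWeighted n d G := by
  obtain ⟨u, hu⟩ := hF
  exact ⟨u, fun z => by rw [← h z z.2, hu]⟩

theorem MemWeighted.add {n d : ℕ} {F G : EuclideanSpace ℂ (Fin n) → ℂ} (hF : MemWeighted n d F)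
    (hG : MemWeighted n d G) : MemWeighted n d (fun z => F z + G z) := by
  obtain ⟨u, hu⟩ := hF
  obtain ⟨v, hv⟩ := hG
  exact ⟨u + v, fun z => by simp only [inner_add_right, hu, hv]⟩

theorem MemWeighted.const_mul {n d : ℕ} {F : EuclideanSpace ℂ (Fin n) → ℂ}
    (hF : MemWeighted n d F) (c : ℂ) : MemWeighted n d (fun z => c * F z) := by
  obtain ⟨u, hu⟩ := hF
  exact ⟨c • u, fun z => by simp only [inner_smul_right, hu]⟩

theorem MemWeighted.sub {n d : ℕ} {F G : EuclideanSpace ℂ (Fin n) → ℂ} (hF : MemWeighted n d F)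
    (hG : MemWeighted n d G) : MemWeighted n d (fun z => F z - G z) :=
  (hF.add (hG.const_mul (-1))).congr fun z _ => by ring

theorem isWeightedMultiplier_iff {n d : ℕ} {φ : EuclideanSpace ℂ (Fin n) → ℂ} :
    IsWeightedMultiplier n d φ ↔
      FeatureMulBound (fun z : Metric.ball (0 : EuclideanSpace ℂ (Fin n)) 1 => φ z)
        (wordFeature n d) (wordFeature n d) := by
  classical
  constructor
  · intro h
    refine featureMulBound_of_forall fun u => ?_
    -- A vector of the word space determines values on the ball only; extension by zero produces a
    -- function on the whole space.
    obtain ⟨v, hv⟩ := h (fun z => if hz : z ∈ Metric.ball (0 : EuclideanSpace ℂ (Fin n)) 1 then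
      ⟪wordFeature n d ⟨z, hz⟩, u⟫_ℂ else 0) ⟨u, fun z => by simp only [z.2, dite_true]⟩
    refine ⟨v, fun z => ?_⟩
    rw [← hv z]
    simp only [z.2, dite_true]
  · rintro h F ⟨u, hu⟩
    obtain ⟨v, hv⟩ := h.exists_mul_eq_inner u
    exact ⟨v, fun z => by simp only [← hv z, hu]⟩

open scoped ComplexOrder in
/-- Multipliers stay multipliers when the kernel is multiplied by a positive one. -/
theorem IsWeightedMultiplier.succ {n d : ℕ} {φ : EuclideanSpace ℂ (Fin n) → ℂ}
    (h : IsWeightedMultiplier n d φ) : IsWeightedMultiplier n (d + 1) φ := by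
  rw [isWeightedMultiplier_iff, featureMulBound_iff] at h ⊢
  obtain ⟨C, hC⟩ := h
  refine ⟨C, ?_⟩
  convert! hC.hadamard (posSemidef_gram_feature (wordFeature n 0)) using 1
  ext x y
  simp only [Matrix.hadamard_apply, Matrix.of_apply, inner_wordFeature]
  have : 1 - ⟪(y : EuclideanSpace ℂ (Fin n)), x⟫_ℂ ≠ 0 := by
    intro h0
    have h1 := norm_inner_lt_one_of_ball y x
    rw [← sub_eq_zero.mp h0] at h1
    simp at h1
  field_simp
  ring

theorem IsWeightedMultiplier.mono {n d e : ℕ} {φ : EuclideanSpace ℂ (Fin n) → ℂ}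
    (h : IsWeightedMultiplier n d φ) (hde : d ≤ e) : IsWeightedMultiplier n e φ := by
  induction e, hde using Nat.le_induction with
  | base => exact h
  | succ e _ ih => exact ih.succ

/-- Each feature vector is an eigenvector of the adjoint, with eigenvalue conj (φ z); it is nonzero
because its component of degree 0 has norm 1. -/
theorem IsWeightedMultiplier.bounded {n d : ℕ} {φ : EuclideanSpace ℂ (Fin n) → ℂ}
    (h : IsWeightedMultiplier n d φ) :
    ∃ C : ℝ, ∀ z ∈ Metric.ball (0 : EuclideanSpace ℂ (Fin n)) 1, ‖φ z‖ ≤ C := by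
  obtain ⟨C, hC⟩ := isWeightedMultiplier_iff.mp h
  refine ⟨C, fun z hz => ?_⟩
  have h1 := hC (Finsupp.single ⟨z, hz⟩ 1)
  simp only [linearCombination_single, one_smul, norm_smul, RCLike.norm_conj] at h1
  have h2 : wordFeature n d ⟨z, hz⟩ ≠ 0 := by
    intro h0
    have h3 := congrArg (fun u : WordSpace n => ‖u 0‖) h0
    simp [wordFeature_apply, norm_wordPower] at h3
  exact le_of_mul_le_mul_right h1 (norm_pos_iff.mpr h2)

/-- The kernel functions of `DruryArveson n` and the word features of order 0 have the same Gram
matrix, so linear combinations have equal norms. Membership depends only on these norms, by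
`exists_eq_inner_of_bound`. -/
theorem memDruryArveson_iff {n : ℕ} {F : EuclideanSpace ℂ (Fin n) → ℂ} :
    MemDruryArveson n F ↔ MemWeighted n 0 F := by
  let k : Metric.ball (0 : EuclideanSpace ℂ (Fin n)) 1 → DruryArveson n := fun z =>
    RKHS.kerFun (DruryArveson n) z 1
  have hk : ∀ x y, ⟪k x, k y⟫_ℂ = ⟪wordFeature n 0 x, wordFeature n 0 y⟫_ℂ := fun x y => by
    simp only [k]
    rw [← RKHS.kernel_inner, RKHS.OfKernel.kernel_ofKernel, inner_wordFeature]
    simp [druryArvesonKernel]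
  have hnorm : ∀ c : Metric.ball (0 : EuclideanSpace ℂ (Fin n)) 1 →₀ ℂ,
      ‖linearCombination ℂ k c‖ = ‖linearCombination ℂ (wordFeature n 0) c‖ := by
    intro c
    have h1 := inner_linearCombination_self k c
    simp only [hk] at h1
    rw [inner_linearCombination_self] at h1
    exact ((sq_eq_sq₀ (norm_nonneg _) (norm_nonneg _)).mp (Complex.ofReal_injective h1)).symm
  have hval : ∀ (u : DruryArveson n) z, ⟪k z, u⟫_ℂ = u z := fun u z => by
    simp [k]
  constructor
  · rintro ⟨u, hu⟩
    obtain ⟨v, hv⟩ := exists_eq_inner_of_bound (wordFeature n 0)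
      (fun z : Metric.ball (0 : EuclideanSpace ℂ (Fin n)) 1 => F z) ‖u‖ fun c => by
        rw [← hnorm]
        convert norm_linearCombination_inner_le k u c using 4 
        funext z
        rw [hval, hu]
    exact ⟨v, hv⟩
  · rintro ⟨u, hu⟩
    obtain ⟨v, hv⟩ := exists_eq_inner_of_bound k
      (fun z : Metric.ball (0 : EuclideanSpace ℂ (Fin n)) 1 => F z) ‖u‖ fun c => by
        rw [hnorm]
        convert norm_linearCombination_inner_le (wordFeature n 0) u c using 4 
        funext z
        rw [hu]
    exact ⟨v, fun z => by rw [hv, hval]⟩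

theorem hasSum_inner_wordFeature {n d : ℕ} (z : Metric.ball (0 : EuclideanSpace ℂ (Fin n)) 1)
    (u : WordSpace n) :
    HasSum (fun m => ((√((m + d).choose d : ℝ) : ℝ) : ℂ) *
      ⟪wordPower m (z : EuclideanSpace ℂ (Fin n)), u m⟫_ℂ) ⟪wordFeature n d z, u⟫_ℂ := by
  have h : ∀ m, ⟪wordFeature n d z m, u m⟫_ℂ = ((√((m + d).choose d : ℝ) : ℝ) : ℂ) *
      ⟪wordPower m (z : EuclideanSpace ℂ (Fin n)), u m⟫_ℂ := fun m => by
    rw [wordFeature_apply, inner_smul_left, Complex.conj_ofReal]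
  exact (funext h) ▸ lp.hasSum_inner (wordFeature n d z) u

theorem MemWeighted.hasSum {n d : ℕ} {F : EuclideanSpace ℂ (Fin n) → ℂ} (hF : MemWeighted n d F) :
    ∃ u : WordSpace n, ∀ z ∈ Metric.ball (0 : EuclideanSpace ℂ (Fin n)) 1,
      HasSum (fun m => ((√((m + d).choose d : ℝ) : ℝ) : ℂ) * ⟪wordPower m z, u m⟫_ℂ) (F z) := by
  obtain ⟨u, hu⟩ := hF
  exact ⟨u, fun z hz => hu ⟨z, hz⟩ ▸ hasSum_inner_wordFeature ⟨z, hz⟩ u⟩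

/-- Dividing the coefficients by the weights of the space leaves a square summable sequence. Passing
from one space of the scale to another reduces to this comparison of weights. -/
theorem memWeighted_of_hasSum {n d : ℕ} {F : EuclideanSpace ℂ (Fin n) → ℂ} (u : WordSpace n)
    (b : ℕ → ℝ) (C : ℝ) (hb : ∀ m, b m ^ 2 ≤ C * (m + d).choose d)
    (hF : ∀ z ∈ Metric.ball (0 : EuclideanSpace ℂ (Fin n)) 1,
      HasSum (fun m => (b m : ℂ) * ⟪wordPower m z, u m⟫_ℂ) (F z)) : MemWeighted n d F := by
  have hpos : ∀ m : ℕ, (0 : ℝ) < (m + d).choose d := fun m => by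
    exact_mod_cast Nat.choose_pos (by omega)
  refine ⟨⟨fun m => ((b m / √((m + d).choose d : ℝ) : ℝ) : ℂ) • u m, ?_⟩, fun z => ?_⟩
  · change Memℓp _ 2
    rw [memℓp_two_word]
    refine Summable.of_nonneg_of_le (fun m => by positivity) (fun m => ?_)
      ((memℓp_two_word.mp (lp.memℓp u)).mul_left C)
    rw [norm_smul, mul_pow, Complex.norm_real, Real.norm_eq_abs, sq_abs, div_pow,
      Real.sq_sqrt (hpos m).le]
    exact mul_le_mul_of_nonneg_right ((div_le_iff₀ (hpos m)).mpr (hb m)) (by positivity)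
  · refine (hF z z.2).unique ?_
    refine (funext fun m => ?_ : (fun m => _) = fun m => _) ▸ hasSum_inner_wordFeature z _
    change _ * ⟪_, ((b m / √((m + d).choose d : ℝ) : ℝ) : ℂ) • u m⟫_ℂ = _
    rw [inner_smul_right, ← mul_assoc, ← Complex.ofReal_mul,
      mul_div_cancel₀ _ (Real.sqrt_pos.mpr (hpos m)).ne']

theorem memWeighted_const {n d : ℕ} (c : ℂ) : MemWeighted n d (fun _ => c) := by
  classical
  let w : WordSpace n := lp.single 2 0 (WithLp.toLp 2 fun _ => c)
  refine memWeighted_of_hasSum w (fun m => if m = 0 then 1 else 0) 1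
    (fun m => ?_) fun z _ => ?_
  · rcases eq_or_ne m 0 with rfl | hm
    · simp
    · simp [hm]
  · convert hasSum_single (f := fun m => (((if m = 0 then 1 else 0 : ℝ)) : ℂ) *
      ⟪wordPower m z, w m⟫_ℂ) 0 (fun m hm => by simp [hm]) using 1
    simp [w, wordPower, PiLp.inner_apply]

end WeightedSpaces

/-! ### The radial derivative as a link between orders d and d + 2 -/

section RadialDerivative

open ComplexConjugate

open scoped InnerProductSpace

/-- The homogeneous polynomial `z ↦ ⟪wordPower m z, u⟫` as a multilinear map. -/
noncomputable def wordMultilinear {n m : ℕ} (u : EuclideanSpace ℂ (Fin m → Fin n)) :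
    ContinuousMultilinearMap ℂ (fun _ : Fin m => EuclideanSpace ℂ (Fin n)) ℂ :=
  ∑ w : Fin m → Fin n, u w • (ContinuousMultilinearMap.mkPiAlgebra ℂ (Fin m) ℂ).compContinuousLinearMap
    (fun i => EuclideanSpace.proj (w i))

theorem wordMultilinear_apply {n m : ℕ} (u : EuclideanSpace ℂ (Fin m → Fin n))
    (v : Fin m → EuclideanSpace ℂ (Fin n)) :
    wordMultilinear u v = ∑ w : Fin m → Fin n, u w * ∏ i, v i (w i) := by
  simp [wordMultilinear]

/-- The value at v is an inner product of `u` with the tensor product of the vectors v i, whose norm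
is the product of their norms; then Cauchy–Schwarz applies. -/
theorem norm_wordMultilinear_le {n m : ℕ} (u : EuclideanSpace ℂ (Fin m → Fin n)) :
    ‖wordMultilinear u‖ ≤ ‖u‖ := by
  refine ContinuousMultilinearMap.opNorm_le_bound (norm_nonneg _) fun v => ?_
  let p : EuclideanSpace ℂ (Fin m → Fin n) := WithLp.toLp 2 fun w => conj (∏ i, v i (w i))
  have h1 : wordMultilinear u v = ⟪p, u⟫_ℂ := by
    rw [wordMultilinear_apply, PiLp.inner_apply]
    simp [p]
  have h2 : ‖p‖ = ∏ i, ‖v i‖ := by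
    rw [← sq_eq_sq₀ (norm_nonneg _) (by positivity), EuclideanSpace.norm_sq_eq,
      ← Finset.prod_pow]
    simp only [EuclideanSpace.norm_sq_eq]
    rw [Fintype.prod_sum]
    refine Finset.sum_congr rfl fun w _ => ?_
    simp [p, Finset.prod_pow]
  rw [h1, ← h2, mul_comm]
  exact norm_inner_le_norm _ _

theorem wordMultilinear_diag {n m : ℕ} (u : EuclideanSpace ℂ (Fin m → Fin n))
    (z : EuclideanSpace ℂ (Fin n)) : wordMultilinear u (fun _ => z) = ⟪wordPower m z, u⟫_ℂ := by
  rw [wordMultilinear_apply, PiLp.inner_apply]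
  simp [wordPower]

/-- The homogeneous parts have multilinear norms at most a binomial coefficient times `‖u‖`. This
growth is polynomial in the degree, so the radius of convergence is at least 1. -/
theorem MemWeighted.analyticOnNhd {n d : ℕ} {F : EuclideanSpace ℂ (Fin n) → ℂ}
    (hF : MemWeighted n d F) : AnalyticOnNhd ℂ F (Metric.ball 0 1) := by
  obtain ⟨u, hu⟩ := hF.hasSum
  let p : FormalMultilinearSeries ℂ (EuclideanSpace ℂ (Fin n)) ℂ := fun m =>
    ((√((m + d).choose d : ℝ) : ℝ) : ℂ) • wordMultilinear (u m)
  have hr : 1 ≤ p.radius := by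
    refine ENNReal.le_of_forall_nnreal_lt fun r hr => p.le_radius_of_summable_norm ?_
    have hr1 : (r : ℝ) < 1 := by exact_mod_cast hr
    have h1 : ‖((r : ℝ))‖ < 1 := by simpa using hr1
    refine Summable.of_nonneg_of_le (fun m => by positivity) (fun m => ?_)
      ((hasSum_choose_mul_geometric_of_norm_lt_one d h1).summable.mul_right ‖u‖)
    rw [norm_smul, Complex.norm_real, Real.norm_of_nonneg (Real.sqrt_nonneg _)]
    have h2 : ‖wordMultilinear (u m)‖ ≤ ‖u‖ :=
      (norm_wordMultilinear_le _).trans (lp.norm_apply_le_norm (by norm_num) u m)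
    have h3 : √((m + d).choose d : ℝ) ≤ (m + d).choose d := by
      rw [Real.sqrt_le_left (by positivity)]
      have : (1 : ℝ) ≤ (m + d).choose d := by exact_mod_cast Nat.choose_pos (by omega)
      nlinarith
    calc _ ≤ ((m + d).choose d : ℝ) * ‖u‖ * (r : ℝ) ^ m := by gcongr
      _ = _ := by ring
  have h : HasFPowerSeriesOnBall F p 0 1 := by
    refine ⟨hr, one_pos, fun {y} hy => ?_⟩
    have hy' : y ∈ Metric.ball (0 : EuclideanSpace ℂ (Fin n)) 1 := by
      rwa [← Metric.eball_ofReal, ENNReal.ofReal_one]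
    rw [zero_add]
    refine (funext fun m => ?_ : (fun m => _) = fun m => _) ▸ hu y hy'
    simp [p, wordMultilinear_diag]
  have h2 := h.analyticOnNhd
  intro z hz
  refine h2 z ?_
  rwa [← Metric.eball_ofReal, ENNReal.ofReal_one] at hz

/-- The radial derivative `(R F)(z) = d/dλ F(λ z)` at `λ = 1`. -/
noncomputable def radialDeriv {n : ℕ} (F : EuclideanSpace ℂ (Fin n) → ℂ)
    (z : EuclideanSpace ℂ (Fin n)) : ℂ :=
  deriv (fun a : ℂ => F (a • z)) 1

theorem hasSum_radialDeriv {n : ℕ} {F : EuclideanSpace ℂ (Fin n) → ℂ}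
    {c : ℕ → EuclideanSpace ℂ (Fin n) → ℂ} (hc : ∀ (m : ℕ) (a : ℂ) z, c m (a • z) = a ^ m * c m z)
    (hF : ∀ z ∈ Metric.ball (0 : EuclideanSpace ℂ (Fin n)) 1, HasSum (fun m => c m z) (F z))
    {z : EuclideanSpace ℂ (Fin n)} (hz : z ∈ Metric.ball (0 : EuclideanSpace ℂ (Fin n)) 1) :
    HasSum (fun m : ℕ => (m : ℂ) * c m z) (radialDeriv F z) := by
  have hz' : ‖z‖ < 1 := mem_ball_zero_iff.mp hz
  -- The slice through z extends beyond the unit circle. Convergence at a = ρ gives a majorant on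
  -- the disc of radius ρ, and 1 is interior to it, which justifies termwise differentiation.
  obtain ⟨ρ, hρ, hρz⟩ : ∃ ρ : ℝ, 1 < ρ ∧ ρ * ‖z‖ < 1 := by
    have h1 : Filter.Tendsto (fun ρ : ℝ => ρ * ‖z‖) (nhdsWithin 1 (Set.Ioi 1))
        (nhds (1 * ‖z‖)) :=
      ((continuous_id.mul continuous_const).tendsto 1).mono_left nhdsWithin_le_nhds
    rw [one_mul] at h1
    exact ((eventually_mem_nhdsWithin).and (h1.eventually_lt_const hz')).exists
  have hmem : ∀ a : ℂ, ‖a‖ ≤ ρ → a • z ∈ Metric.ball (0 : EuclideanSpace ℂ (Fin n)) 1 := by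
    intro a ha
    rw [mem_ball_zero_iff, norm_smul]
    exact (mul_le_mul_of_nonneg_right ha (norm_nonneg _)).trans_lt hρz
  have hsum : Summable fun m => ‖(ρ : ℂ) ^ m * c m z‖ := by
    have := (hF _ (hmem (ρ : ℂ) (by simp [abs_of_pos (one_pos.trans hρ)]))).summable.norm
    simpa only [hc] using this
  have h1 := Complex.hasSum_deriv_of_summable_norm (F := fun m (a : ℂ) => a ^ m * c m z)
    (U := Metric.ball (0 : ℂ) ρ) (z := 1) hsum (fun m => by fun_prop) Metric.isOpen_ball
    (fun m a ha => by
      rw [norm_mul, norm_mul, norm_pow, norm_pow, Complex.norm_real,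
        Real.norm_of_nonneg (one_pos.trans hρ).le]
      have := (mem_ball_zero_iff.mp ha).le
      gcongr) (by simpa using hρ)
  have h2 : (fun a : ℂ => F (a • z)) =ᶠ[nhds 1] fun a => ∑' m, a ^ m * c m z := by
    filter_upwards [Metric.isOpen_ball.mem_nhds (show (1 : ℂ) ∈ Metric.ball (0 : ℂ) ρ by
      simpa using hρ)] with a ha
    have := hF _ (hmem a (mem_ball_zero_iff.mp ha).le)
    simp only [hc] at this
    exact this.tsum_eq.symm
  rw [radialDeriv, h2.deriv_eq]
  refine (funext fun m => ?_ : (fun m => _) = fun m => _) ▸ h1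
  simp

theorem differentiableAt_slice {n : ℕ} {F : EuclideanSpace ℂ (Fin n) → ℂ}
    (hF : AnalyticOnNhd ℂ F (Metric.ball 0 1)) {z : EuclideanSpace ℂ (Fin n)} {a : ℂ}
    (hz : a • z ∈ Metric.ball (0 : EuclideanSpace ℂ (Fin n)) 1) :
    DifferentiableAt ℂ (fun b : ℂ => F (b • z)) a :=
  DifferentiableAt.comp (g := F) a (hF _ hz).differentiableAt (by fun_prop)

/-- The exact form of the statement that the squared weights of orders d + 2 and d differ by a
factor of order m²; both directions of the link use it. -/
theorem choose_add_two_mul (m d : ℕ) :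
    ((m + (d + 2)).choose (d + 2) : ℝ) * ((d + 1) * (d + 2)) =
      ((m + d).choose d : ℝ) * ((m + d + 1) * (m + d + 2)) := by
  have h1 := Nat.add_one_mul_choose_eq (m + d) d
  have h2 := Nat.add_one_mul_choose_eq (m + d + 1) (d + 1)
  have h1' : ((m : ℝ) + d + 1) * (m + d).choose d = (m + d + 1).choose (d + 1) * (d + 1) := by
    exact_mod_cast h1
  have h2' : ((m : ℝ) + d + 2) * (m + d + 1).choose (d + 1) =
      (m + (d + 2)).choose (d + 2) * (d + 2) := by
    have e1 : m + d + 1 + 1 = m + (d + 2) := by ring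
    rw [e1] at h2
    have : ((m + (d + 2) : ℕ) : ℝ) * (m + d + 1).choose (d + 1) =
      (m + (d + 2)).choose (d + 2) * ((d + 1 + 1 : ℕ) : ℝ) := by exact_mod_cast h2
    push_cast at this
    linear_combination this
  linear_combination (-((d : ℝ) + 1)) * h2' - (m + d + 2) * h1'

theorem MemWeighted.radialDeriv {n d : ℕ} {F : EuclideanSpace ℂ (Fin n) → ℂ}
    (hF : MemWeighted n d F) : MemWeighted n (d + 2) (radialDeriv F) := by
  obtain ⟨u, hu⟩ := hF.hasSum
  refine memWeighted_of_hasSum u (fun m => m * √((m + d).choose d : ℝ)) ((d + 1) * (d + 2))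
    (fun m => ?_) fun z hz => ?_
  · rw [mul_pow, Real.sq_sqrt (Nat.cast_nonneg _)]
    have h1 := choose_add_two_mul m d
    have h2 : (0 : ℝ) ≤ (m + d).choose d := Nat.cast_nonneg _
    have h3 : (m : ℝ) ^ 2 ≤ (m + d + 1) * (m + d + 2) := by
      have : (0 : ℝ) ≤ m := Nat.cast_nonneg _
      have : (0 : ℝ) ≤ d := Nat.cast_nonneg _
      nlinarith [mul_nonneg ‹(0 : ℝ) ≤ m› ‹(0 : ℝ) ≤ d›]
    nlinarith [mul_le_mul_of_nonneg_left h3 h2]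
  · have := hasSum_radialDeriv (fun m a z => by rw [inner_wordPower_smul]; ring) hu hz
    refine (funext fun m => ?_ : (fun m => _) = fun m => _) ▸ this
    push_cast
    ring

/-- An analytic function with vanishing radial derivative is constant. -/
theorem eq_of_radialDeriv_eq_zero {n : ℕ} {F : EuclideanSpace ℂ (Fin n) → ℂ}
    (hF : AnalyticOnNhd ℂ F (Metric.ball 0 1))
    (h : ∀ z ∈ Metric.ball (0 : EuclideanSpace ℂ (Fin n)) 1, radialDeriv F z = 0)
    {z : EuclideanSpace ℂ (Fin n)} (hz : z ∈ Metric.ball (0 : EuclideanSpace ℂ (Fin n)) 1) :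
    F z = F 0 := by
  have hmem : ∀ t ∈ Set.Icc (0 : ℝ) 1, ((1 - t : ℝ) : ℂ) • z ∈
      Metric.ball (0 : EuclideanSpace ℂ (Fin n)) 1 := by
    intro t ht
    have := mem_ball_zero_iff.mp hz
    rw [mem_ball_zero_iff, norm_smul, Complex.norm_real,
      Real.norm_of_nonneg (by linarith [ht.2])]
    nlinarith [norm_nonneg z, ht.1, ht.2]
  have hd : ∀ t ∈ Set.Icc (0 : ℝ) 1, HasDerivAt (fun a : ℂ => F (a • z))
      (deriv (fun a : ℂ => F (a • z)) ((1 - t : ℝ) : ℂ)) ((1 - t : ℝ) : ℂ) := fun t ht =>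
    (differentiableAt_slice hF (hmem t ht)).hasDerivAt
  -- The radial derivative at (1 - t)z is (1 - t) times the slice derivative, so it says nothing at
  -- the origin. Running the segment from z to 0 places that point at t = 1, the endpoint the
  -- constancy lemma does not need.
  have hd0 : ∀ t ∈ Set.Ico (0 : ℝ) 1, deriv (fun a : ℂ => F (a • z)) ((1 - t : ℝ) : ℂ) = 0 := by
    intro t ht
    have ht' : t ∈ Set.Icc (0 : ℝ) 1 := ⟨ht.1, ht.2.le⟩
    have h1 := h _ (hmem t ht')
    have h2 : HasDerivAt (fun a : ℂ => F (a • (((1 - t : ℝ) : ℂ) • z)))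
        (deriv (fun a : ℂ => F (a • z)) ((1 - t : ℝ) : ℂ) * ((1 - t : ℝ) : ℂ)) 1 := by
      have h3 := hd t ht'
      have h4 : HasDerivAt (fun a : ℂ => a * ((1 - t : ℝ) : ℂ)) ((1 - t : ℝ) : ℂ) 1 := by
        simpa using (hasDerivAt_id (1 : ℂ)).mul_const ((1 - t : ℝ) : ℂ)
      have h5 := HasDerivAt.comp (h₂ := fun a : ℂ => F (a • z)) (1 : ℂ)
        (by rw [one_mul]; exact h3) h4
      refine h5.congr_of_eventuallyEq (Filter.Eventually.of_forall fun a => ?_)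
      simp [smul_smul]
    rw [radialDeriv, h2.deriv] at h1
    refine (mul_eq_zero.mp h1).resolve_right ?_
    have : (1 - t : ℝ) ≠ 0 := by linarith [ht.2]
    exact_mod_cast this
  have hR : ∀ t ∈ Set.Icc (0 : ℝ) 1, HasDerivAt (fun s : ℝ => F (((1 - s : ℝ) : ℂ) • z))
      (deriv (fun a : ℂ => F (a • z)) ((1 - t : ℝ) : ℂ) * (-1)) t := by
    intro t ht
    have h4 : HasDerivAt (fun s : ℝ => ((1 - s : ℝ) : ℂ)) (-1) t := by
      have := ((hasDerivAt_id t).const_sub 1).ofReal_comp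
      simpa using this
    exact HasDerivAt.comp t (hd t ht) h4
  have hconst := constant_of_has_deriv_right_zero (f := fun s : ℝ => F (((1 - s : ℝ) : ℂ) • z))
    (a := 0) (b := 1) (fun t ht => (hR t ht).continuousAt.continuousWithinAt)
    (fun t ht => by
      have := hR t ⟨ht.1, ht.2.le⟩
      rw [hd0 t ht, zero_mul] at this
      exact this.hasDerivWithinAt) 1 (by simp)
  simpa using hconst.symm

theorem radialDeriv_sub {n : ℕ} {F G : EuclideanSpace ℂ (Fin n) → ℂ}
    (hF : AnalyticOnNhd ℂ F (Metric.ball 0 1)) (hG : AnalyticOnNhd ℂ G (Metric.ball 0 1))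
    {z : EuclideanSpace ℂ (Fin n)} (hz : z ∈ Metric.ball (0 : EuclideanSpace ℂ (Fin n)) 1) :
    radialDeriv (fun z => F z - G z) z = radialDeriv F z - radialDeriv G z :=
  deriv_fun_sub (differentiableAt_slice hF (by rwa [one_smul]))
    (differentiableAt_slice hG (by rwa [one_smul]))

theorem radialDeriv_mul {n : ℕ} {F G : EuclideanSpace ℂ (Fin n) → ℂ}
    (hF : AnalyticOnNhd ℂ F (Metric.ball 0 1)) (hG : AnalyticOnNhd ℂ G (Metric.ball 0 1))
    {z : EuclideanSpace ℂ (Fin n)} (hz : z ∈ Metric.ball (0 : EuclideanSpace ℂ (Fin n)) 1) :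
    radialDeriv (fun z => F z * G z) z = radialDeriv F z * G z + F z * radialDeriv G z := by
  have := deriv_fun_mul (differentiableAt_slice hF (z := z) (a := 1) (by rwa [one_smul]))
    (differentiableAt_slice hG (by rwa [one_smul]))
  simp only [one_smul] at this
  exact this

/-- An analytic function whose radial derivative lies in the space of order `d + 2` lies in the
space of order `d`. -/
theorem memWeighted_of_radialDeriv {n d : ℕ} {F : EuclideanSpace ℂ (Fin n) → ℂ}
    (hF : AnalyticOnNhd ℂ F (Metric.ball 0 1)) (h : MemWeighted n (d + 2) (radialDeriv F)) :
    MemWeighted n d F := by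
  classical
  obtain ⟨u, hu⟩ := h.hasSum
  -- Radial integration divides the part of degree m by m. Division by zero makes `b 0 = 0`, which
  -- drops the constant term.
  let b : ℕ → ℝ := fun m => √((m + (d + 2)).choose (d + 2) : ℝ) / m
  have hbC : ∀ m, b m ^ 2 ≤ (d + 3) ^ 2 * ((m + d).choose d : ℝ) := by
    intro m
    rcases Nat.eq_zero_or_pos m with rfl | hm
    · simp [b]
      positivity
    · have hm' : (1 : ℝ) ≤ m := by exact_mod_cast hm
      have hd' : (0 : ℝ) ≤ d := Nat.cast_nonneg _
      have hc : (0 : ℝ) ≤ (m + d).choose d := Nat.cast_nonneg _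
      have h1 := choose_add_two_mul m d
      rw [div_pow, Real.sq_sqrt (Nat.cast_nonneg _), div_le_iff₀ (by positivity)]
      have h2 : ((m : ℝ) + d + 1) * (m + d + 2) ≤ ((d + 3) * m) * ((d + 3) * m) := by
        apply mul_le_mul <;> nlinarith
      have h3 : (1 : ℝ) ≤ (d + 1) * (d + 2) := by nlinarith
      have h4 : (0 : ℝ) ≤ (m + (d + 2)).choose (d + 2) := Nat.cast_nonneg _
      calc ((m + (d + 2)).choose (d + 2) : ℝ)
          ≤ (m + (d + 2)).choose (d + 2) * ((d + 1) * (d + 2)) := le_mul_of_one_le_right h4 h3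
        _ = (m + d).choose d * ((m + d + 1) * (m + d + 2)) := h1
        _ ≤ (m + d).choose d * (((d + 3) * m) * ((d + 3) * m)) :=
          mul_le_mul_of_nonneg_left h2 hc
        _ = _ := by ring
  let c : ℕ → EuclideanSpace ℂ (Fin n) → ℂ := fun m z => (b m : ℂ) * ⟪wordPower m z, u m⟫_ℂ
  let G : EuclideanSpace ℂ (Fin n) → ℂ := fun z => ∑' m, c m z
  have hGsum : ∀ z ∈ Metric.ball (0 : EuclideanSpace ℂ (Fin n)) 1,
      HasSum (fun m => c m z) (G z) := by
    intro z hz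
    refine Summable.hasSum (Summable.of_norm ?_)
    refine Summable.of_nonneg_of_le (fun m => norm_nonneg _) (fun m => ?_) (hu z hz).summable.norm
    simp only [c, norm_mul, Complex.norm_real]
    refine mul_le_mul_of_nonneg_right ?_ (norm_nonneg _)
    rw [Real.norm_of_nonneg (by positivity), Real.norm_of_nonneg (by positivity)]
    rcases Nat.eq_zero_or_pos m with rfl | hm
    · simp [b]
    · exact div_le_self (Real.sqrt_nonneg _) (by exact_mod_cast hm)
  have hG : MemWeighted n d G := memWeighted_of_hasSum u b _ hbC hGsum
  have hRG : ∀ z ∈ Metric.ball (0 : EuclideanSpace ℂ (Fin n)) 1,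
      radialDeriv F z = radialDeriv G z := by
    intro z hz
    -- Only the part of degree 0 can differ. It is constant, and it vanishes because every radial
    -- derivative is zero at the origin.
    have h0 : ∀ z ∈ Metric.ball (0 : EuclideanSpace ℂ (Fin n)) 1,
        radialDeriv F z - radialDeriv G z = ⟪wordPower 0 z, u 0⟫_ℂ := by
      intro z hz
      have h1 := hasSum_radialDeriv (c := c)
        (fun m a z => by simp only [c, inner_wordPower_smul]; ring) hGsum hz
      refine ((hu z hz).sub h1).unique ?_
      have h2 := hasSum_single (f := fun m : ℕ => ((√((m + (d + 2)).choose (d + 2) : ℝ) : ℝ) : ℂ) *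
        ⟪wordPower m z, u m⟫_ℂ - m * c m z) 0 (fun m hm => by
          have : (m : ℂ) ≠ 0 := by exact_mod_cast hm
          simp only [c, b]
          push_cast
          field_simp
          ring)
      simpa [c] using h2
    have h00 := h0 0 (by simp)
    have e0 : ∀ H : EuclideanSpace ℂ (Fin n) → ℂ, radialDeriv H 0 = 0 := fun H => by
      simp [radialDeriv]
    have hw : wordPower 0 z = wordPower 0 (0 : EuclideanSpace ℂ (Fin n)) := by
      simp [wordPower]
    have h2 := h0 z hz
    rw [hw, ← h00, e0, e0, sub_zero] at h2
    exact sub_eq_zero.mp h2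
  have hFG := fun z => eq_of_radialDeriv_eq_zero (z := z) (F := fun z => F z - G z) (hF.sub hG.analyticOnNhd)
    (fun z hz => by rw [radialDeriv_sub hF hG.analyticOnNhd hz, hRG z hz, sub_self])
  refine (hG.add (memWeighted_const (F 0 - G 0))).congr fun z hz => ?_
  rw [← hFG z hz]
  ring

end RadialDerivative

/-! ### Homogeneous expansion of bounded analytic functions -/

section HomogeneousExpansion

open ComplexConjugate

open scoped InnerProductSpace

/-- A multilinear map evaluated on the diagonal, in terms of words in the coordinates. -/
theorem diagonal_eq_inner_wordPower {n m : ℕ}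
    (p : ContinuousMultilinearMap ℂ (fun _ : Fin m => EuclideanSpace ℂ (Fin n)) ℂ)
    (z : EuclideanSpace ℂ (Fin n)) :
    p (fun _ => z) = ⟪wordPower m z,
      WithLp.toLp 2 fun w => p fun i => EuclideanSpace.single (w i) (1 : ℂ)⟫_ℂ := by
  have hz : z = ∑ j, z j • EuclideanSpace.single j (1 : ℂ) := by
    ext i
    simp [Finset.sum_apply, Pi.single_apply]
  have h1 : p (fun _ => z) = p fun _ => ∑ j, z j • EuclideanSpace.single j (1 : ℂ) := by
    rw [← hz]
  rw [h1, p.map_sum, PiLp.inner_apply]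
  refine Finset.sum_congr rfl fun w _ => ?_
  rw [p.map_smul_univ]
  simp [wordPower, mul_comm]

/-- A bounded analytic function on the ball is the sum of its homogeneous components, which obey
the same bound. -/
theorem exists_hasSum_wordPower {n : ℕ} {F : EuclideanSpace ℂ (Fin n) → ℂ}
    (hF : AnalyticOnNhd ℂ F (Metric.ball 0 1)) {M : ℝ}
    (hM : ∀ z ∈ Metric.ball (0 : EuclideanSpace ℂ (Fin n)) 1, ‖F z‖ ≤ M) :
    ∃ u : ∀ m : ℕ, EuclideanSpace ℂ (Fin m → Fin n),
      ∀ z ∈ Metric.ball (0 : EuclideanSpace ℂ (Fin n)) 1,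
        (∀ m, ‖⟪wordPower m z, u m⟫_ℂ‖ ≤ M) ∧ HasSum (fun m => ⟪wordPower m z, u m⟫_ℂ) (F z) := by
  obtain ⟨p, hp⟩ := hF 0 (by simp)
  refine ⟨fun m => WithLp.toLp 2 fun w => p m fun i => EuclideanSpace.single (w i) (1 : ℂ),
    fun z hz => ?_⟩
  simp only [← diagonal_eq_inner_wordPower]
  have hz' : ‖z‖ < 1 := mem_ball_zero_iff.mp hz
  obtain ⟨ρ, hρ, hρz⟩ : ∃ ρ : ℝ, 1 < ρ ∧ ρ * ‖z‖ < 1 := by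
    have h1 : Filter.Tendsto (fun ρ : ℝ => ρ * ‖z‖) (nhdsWithin 1 (Set.Ioi 1))
        (nhds (1 * ‖z‖)) :=
      ((continuous_id.mul continuous_const).tendsto 1).mono_left nhdsWithin_le_nhds
    rw [one_mul] at h1
    exact ((eventually_mem_nhdsWithin).and (h1.eventually_lt_const hz')).exists
  have hmem : ∀ a : ℂ, ‖a‖ ≤ ρ → a • z ∈ Metric.ball (0 : EuclideanSpace ℂ (Fin n)) 1 := by
    intro a ha
    rw [mem_ball_zero_iff, norm_smul]
    exact (mul_le_mul_of_nonneg_right ha (norm_nonneg _)).trans_lt hρz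
  let g : ℂ → ℂ := fun a => F (a • z)
  have hg : DifferentiableOn ℂ g (Metric.ball 0 ρ) := fun a ha =>
    (differentiableAt_slice hF (hmem a (mem_ball_zero_iff.mp ha).le)).differentiableWithinAt
  let L : ℂ →L[ℂ] EuclideanSpace ℂ (Fin n) := (ContinuousLinearMap.id ℂ ℂ).smulRight z
  have hgL : g = F ∘ L := by
    funext a
    simp [g, L]
  -- The series `p` is known to converge only near 0. Its terms are the Taylor coefficients of the
  -- slice g, which is analytic on a disc of radius ρ > 1; this gives convergence at z, and the
  -- Cauchy estimate on the unit circle gives the bound M.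
  have hcoef : ∀ m : ℕ, ((m.factorial : ℂ))⁻¹ * iteratedDeriv m g 0 = p m fun _ => z := by
    intro m
    have h1 : HasFPowerSeriesAt F p (L 0) := by rwa [map_zero]
    obtain ⟨r, hr⟩ := h1.compContinuousLinearMap (u := L)
    have h2 := hr.factorial_smul 1 m
    rw [iteratedDeriv, hgL, ← h2, nsmul_eq_mul, ← mul_assoc,
      inv_mul_cancel₀ (by exact_mod_cast m.factorial_ne_zero), one_mul]
    simp only [FormalMultilinearSeries.compContinuousLinearMap_apply]
    congr 1
    funext i
    simp [L]
  constructor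
  · intro m
    have h1 := Complex.norm_iteratedDeriv_le_of_forall_mem_sphere_norm_le (f := g) (c := 0) m
      one_pos ?_ (C := M) fun a ha => hM _ (hmem a ?_)
    · rw [← hcoef, norm_mul, norm_inv, Complex.norm_natCast,
        inv_mul_le_iff₀ (by exact_mod_cast m.factorial_pos)]
      simpa using h1
    · refine (hg.mono ?_).diffContOnCl
      exact Metric.closure_ball_subset_closedBall.trans (Metric.closedBall_subset_ball hρ)
    · rw [mem_sphere_zero_iff_norm.mp ha]
      exact hρ.le
  · have h1 := Complex.hasSum_taylorSeries_on_ball hg (z := 1) (by simpa using hρ)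
    simp only [sub_zero, one_pow, smul_eq_mul, one_mul, hcoef] at h1
    simpa only [g, one_smul] using h1

end HomogeneousExpansion

/-! ### Moments of monomials over the ball -/

section BallIntegrals

open ComplexConjugate MeasureTheory

/-- The Euclidean unit ball in the coordinate space `Fin n → ℂ`. -/
def coordBall (n : ℕ) : Set (Fin n → ℂ) := {ζ | ∑ i, ‖ζ i‖ ^ 2 < 1}

theorem mem_coordBall_iff {n : ℕ} {ζ : Fin n → ℂ} :
    ζ ∈ coordBall n ↔ WithLp.toLp 2 ζ ∈ Metric.ball (0 : EuclideanSpace ℂ (Fin n)) 1 := by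
  rw [mem_ball_zero_iff, ← sq_lt_one_iff₀ (norm_nonneg _), EuclideanSpace.norm_sq_eq]
  rfl

theorem isOpen_coordBall (n : ℕ) : IsOpen (coordBall n) :=
  isOpen_lt (by fun_prop) continuous_const

theorem norm_apply_lt_one_of_mem_coordBall {n : ℕ} {ζ : Fin n → ℂ} (hζ : ζ ∈ coordBall n)
    (i : Fin n) : ‖ζ i‖ < 1 := by
  rw [← sq_lt_one_iff₀ (norm_nonneg _)]
  exact (Finset.single_le_sum (f := fun i => ‖ζ i‖ ^ 2) (fun i _ => by positivity)
    (Finset.mem_univ i)).trans_lt hζ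

theorem volume_coordBall_lt_top (n : ℕ) : volume (coordBall n) < ⊤ := by
  refine (measure_mono (fun ζ hζ => ?_)).trans_lt (measure_ball_lt_top (x := (0 : Fin n → ℂ))
    (r := 1))
  rw [mem_ball_zero_iff, pi_norm_lt_iff one_pos]
  exact norm_apply_lt_one_of_mem_coordBall hζ

instance isFiniteMeasure_restrict_coordBall (n : ℕ) :
    IsFiniteMeasure (volume.restrict (coordBall n)) :=
  ⟨by simpa using volume_coordBall_lt_top n⟩

/-- Coordinatewise rotations preserve integrals over the ball. -/
theorem setIntegral_coordBall_rotation {n : ℕ} (c : Fin n → Circle) (g : (Fin n → ℂ) → ℂ) :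
    ∫ ζ in coordBall n, g (fun i => c i * ζ i) = ∫ ζ in coordBall n, g ζ := by
  let e : (Fin n → ℂ) ≃ᵐ (Fin n → ℂ) :=
    MeasurableEquiv.piCongrRight fun i => (rotation (c i)).toHomeomorph.toMeasurableEquiv
  have he : ∀ ζ, e ζ = fun i => c i * ζ i := fun ζ => rfl
  have hmp : MeasurePreserving e volume volume :=
    volume_preserving_pi fun i => (rotation (c i)).measurePreserving
  have hpre : e ⁻¹' coordBall n = coordBall n := by
    ext ζ
    simp [coordBall, he, Circle.norm_coe]
  have := hmp.setIntegral_preimage_emb e.measurableEmbedding g (coordBall n)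
  rw [hpre] at this
  simpa only [he] using this

/-- Distinct monomials are orthogonal over the ball. -/
theorem integral_coordBall_monomial_of_ne {n : ℕ} {a b : Fin n → ℕ} (hab : a ≠ b) :
    ∫ ζ in coordBall n, (∏ i, ζ i ^ a i) * conj (∏ i, ζ i ^ b i) = 0 := by
  obtain ⟨j, hj⟩ := Function.ne_iff.mp hab
  have hj' : ((a j : ℝ) - b j) ≠ 0 := sub_ne_zero.mpr (by exact_mod_cast hj)
  -- Rotating coordinate j by θ multiplies the integrand by exp(i(a_j - b_j)θ) = -1, so the integral
  -- equals its own negative.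
  set θ : ℝ := Real.pi / (a j - b j) with hθ
  let c : Fin n → Circle := fun i => if i = j then Circle.exp θ else 1
  have hc : (∏ i, (c i : ℂ) ^ a i) * conj (∏ i, (c i : ℂ) ^ b i) = -1 := by
    have h1 : ∀ e : Fin n → ℕ, ∏ i, (c i : ℂ) ^ e i = Complex.exp (θ * Complex.I) ^ e j := by
      intro e
      rw [Finset.prod_eq_single j]
      · simp [c]
      · intro i _ hi
        simp [c, hi]
      · simp
    rw [h1, h1, map_pow, ← Complex.exp_conj, ← Complex.exp_nat_mul, ← Complex.exp_nat_mul,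
      ← Complex.exp_add, ← Complex.exp_pi_mul_I]
    congr 1
    have h2 : ((a j : ℂ) - b j) * θ = Real.pi := by
      rw [hθ]
      push_cast
      have : ((a j : ℂ) - b j) ≠ 0 := by exact_mod_cast hj'
      field_simp
    simp only [map_mul, Complex.conj_ofReal, Complex.conj_I]
    linear_combination Complex.I * h2
  have h := setIntegral_coordBall_rotation c
    (fun ζ => (∏ i, ζ i ^ a i) * conj (∏ i, ζ i ^ b i))
  have h2 : ∀ ζ : Fin n → ℂ, (∏ i, (c i * ζ i) ^ a i) * conj (∏ i, (c i * ζ i) ^ b i) =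
      -1 * ((∏ i, ζ i ^ a i) * conj (∏ i, ζ i ^ b i)) := by
    intro ζ
    rw [← hc]
    simp only [mul_pow, Finset.prod_mul_distrib, map_mul]
    ring
  simp only [h2, integral_const_mul] at h
  linear_combination (-1 / 2 : ℂ) * h

open Real in
/-- Gaussian moments of a monomial. -/
theorem lintegral_gaussian_monomial {n : ℕ} (a : Fin n → ℕ) :
    ∫⁻ ζ : Fin n → ℂ, ENNReal.ofReal (∏ i, ‖ζ i‖ ^ (2 * a i)) *
      ENNReal.ofReal (exp (-∑ i, ‖ζ i‖ ^ 2)) =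
      ENNReal.ofReal (π ^ n * ∏ i, ((a i).factorial : ℝ)) := by
  have h1 : ∀ k : ℕ, ∫ x : ℂ, ‖x‖ ^ (2 * k) * exp (-‖x‖ ^ 2) = π * k.factorial := by
    intro k
    have h := Complex.integral_rpow_mul_exp_neg_rpow (p := 2) (q := 2 * k) (by norm_num)
      (by linarith [(Nat.cast_nonneg k : (0 : ℝ) ≤ k)])
    have e1 : ∀ x : ℂ, ‖x‖ ^ (2 * (k : ℝ)) * exp (-‖x‖ ^ (2 : ℝ)) =
        ‖x‖ ^ (2 * k) * exp (-‖x‖ ^ 2) := fun x => by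
      rw [← Real.rpow_natCast, ← Real.rpow_natCast]
      push_cast
      rfl
    simp only [e1] at h
    rw [h, show (2 * (k : ℝ) + 2) / 2 = k + 1 by ring, Real.Gamma_nat_eq_factorial]
    ring
  have h2 : ∀ k : ℕ, Integrable fun x : ℂ => ‖x‖ ^ (2 * k) * exp (-‖x‖ ^ 2) := fun k => by
    refine Integrable.of_integral_ne_zero ?_
    rw [h1]
    positivity
  have h3 : ∀ ζ : Fin n → ℂ, ENNReal.ofReal (∏ i, ‖ζ i‖ ^ (2 * a i)) *
      ENNReal.ofReal (exp (-∑ i, ‖ζ i‖ ^ 2)) =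
      ENNReal.ofReal (∏ i, (‖ζ i‖ ^ (2 * a i) * exp (-‖ζ i‖ ^ 2))) := fun ζ => by
    rw [← ENNReal.ofReal_mul (by positivity), Finset.prod_mul_distrib, ← Real.exp_sum,
      Finset.sum_neg_distrib]
  simp only [h3, volume_pi]
  rw [← ofReal_integral_eq_lintegral_ofReal
    (Integrable.fintype_prod (f := fun i x => ‖x‖ ^ (2 * a i) * exp (-‖x‖ ^ 2)) fun i => h2 (a i))
    (Filter.Eventually.of_forall fun ζ => Finset.prod_nonneg fun i _ => by positivity),
    integral_fintype_prod_eq_prod (fun i x => ‖x‖ ^ (2 * a i) * exp (-‖x‖ ^ 2))]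
  simp only [h1, Finset.prod_mul_distrib, Finset.prod_const, Finset.card_univ, Fintype.card_fin]

/-- Dilation by √s contributes s^n from the real dimension 2n and s^(∑ a i) from the homogeneity of
the integrand. -/
theorem lintegral_scaled_ball_monomial {n : ℕ} (a : Fin n → ℕ) {s : ℝ} (hs : 0 < s) :
    ∫⁻ ζ in {ζ : Fin n → ℂ | ∑ i, ‖ζ i‖ ^ 2 < s}, ENNReal.ofReal (∏ i, ‖ζ i‖ ^ (2 * a i)) =
      ENNReal.ofReal (s ^ (n + ∑ i, a i)) *
        ∫⁻ ζ in coordBall n, ENNReal.ofReal (∏ i, ‖ζ i‖ ^ (2 * a i)) := by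
  set r : ℝ := √s with hr
  have hr0 : 0 < r := Real.sqrt_pos.mpr hs
  have hrs : r ^ 2 = s := Real.sq_sqrt hs.le
  have hms : MeasurableSet {ζ : Fin n → ℂ | ∑ i, ‖ζ i‖ ^ 2 < s} :=
    (isOpen_lt (by fun_prop) continuous_const).measurableSet
  have hmB := (isOpen_coordBall n).measurableSet
  have hq : Measurable fun ζ : Fin n → ℂ => ENNReal.ofReal (∏ i, ‖ζ i‖ ^ (2 * a i)) := by
    fun_prop
  rw [← lintegral_indicator hms, ← lintegral_indicator hmB]
  have h1 := Measure.map_addHaar_smul (volume : Measure (Fin n → ℂ)) hr0.ne'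
  have h2 := lintegral_map (μ := (volume : Measure (Fin n → ℂ))) (hq.indicator hms)
    (measurable_const_smul r)
  rw [h1, lintegral_smul_measure] at h2
  have hfin : Module.finrank ℝ (Fin n → ℂ) = 2 * n := by
    rw [Module.finrank_pi_fintype]
    simp [Complex.finrank_real_complex, mul_comm]
  have h3 : ∀ ζ : Fin n → ℂ, {ζ : Fin n → ℂ | ∑ i, ‖ζ i‖ ^ 2 < s}.indicator
      (fun ζ => ENNReal.ofReal (∏ i, ‖ζ i‖ ^ (2 * a i))) (r • ζ) =
      ENNReal.ofReal (s ^ ∑ i, a i) * (coordBall n).indicator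
        (fun ζ => ENNReal.ofReal (∏ i, ‖ζ i‖ ^ (2 * a i))) ζ := by
    intro ζ
    have hmem : r • ζ ∈ {ζ : Fin n → ℂ | ∑ i, ‖ζ i‖ ^ 2 < s} ↔ ζ ∈ coordBall n := by
      simp only [coordBall, Set.mem_ofPred_eq, Pi.smul_apply, norm_smul, mul_pow,
        Real.norm_of_nonneg hr0.le, hrs, ← Finset.mul_sum]
      exact mul_lt_iff_lt_one_right hs
    by_cases hζ : ζ ∈ coordBall n
    · rw [Set.indicator_of_mem (hmem.mpr hζ), Set.indicator_of_mem hζ,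
        ← ENNReal.ofReal_mul (by positivity)]
      congr 1
      simp only [Pi.smul_apply, norm_smul, mul_pow, Real.norm_of_nonneg hr0.le, pow_mul, hrs,
        Finset.prod_mul_distrib, Finset.prod_pow_eq_pow_sum]
    · rw [Set.indicator_of_notMem (fun h => hζ (hmem.mp h)), Set.indicator_of_notMem hζ, mul_zero]
  simp only [h3] at h2
  rw [lintegral_const_mul _ (hq.indicator hmB), hfin, pow_mul, hrs, abs_of_pos (by positivity),
    smul_eq_mul] at h2
  rw [pow_add, ENNReal.ofReal_mul (by positivity), mul_assoc, ← h2, ← mul_assoc,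
    ← ENNReal.ofReal_mul (by positivity), mul_inv_cancel₀ (by positivity), ENNReal.ofReal_one,
    one_mul]

/-- Moments of a monomial over the ball, obtained from the Gaussian ones. -/
theorem lintegral_coordBall_monomial {n : ℕ} (a : Fin n → ℕ) :
    ENNReal.ofReal ((n + ∑ i, a i).factorial) *
      ∫⁻ ζ in coordBall n, ENNReal.ofReal (∏ i, ‖ζ i‖ ^ (2 * a i)) =
      ENNReal.ofReal (Real.pi ^ n * ∏ i, ((a i).factorial : ℝ)) := by
  rw [← lintegral_gaussian_monomial]
  set q : (Fin n → ℂ) → ENNReal := fun ζ => ENNReal.ofReal (∏ i, ‖ζ i‖ ^ (2 * a i)) with hq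
  have hqm : Measurable q := by fun_prop
  set J := ∫⁻ ζ in coordBall n, q ζ with hJ
  let T : Set ((Fin n → ℂ) × ℝ) := {p | ∑ i, ‖p.1 i‖ ^ 2 < p.2}
  have hT : MeasurableSet T := (isOpen_lt (by fun_prop) continuous_snd).measurableSet
  -- Writing exp(-|ζ|²) as the integral of exp(-s) over s > |ζ|² turns the Gaussian moment, after
  -- Tonelli, into an integral of moments over balls of radius √s.
  have h1 : ∀ ζ : Fin n → ℂ, ENNReal.ofReal (Real.exp (-∑ i, ‖ζ i‖ ^ 2)) =
      ∫⁻ s : ℝ, T.indicator (fun p => ENNReal.ofReal (Real.exp (-p.2))) (ζ, s) := by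
    intro ζ
    rw [← integral_exp_neg_Ioi, ofReal_integral_eq_lintegral_ofReal
      (integrableOn_exp_neg_Ioi _) (Filter.Eventually.of_forall fun s => (Real.exp_pos _).le),
      ← lintegral_indicator measurableSet_Ioi]
    refine lintegral_congr fun s => ?_
    by_cases h : ∑ i, ‖ζ i‖ ^ 2 < s
    · rw [Set.indicator_of_mem (show s ∈ Set.Ioi _ from h),
        Set.indicator_of_mem (show (ζ, s) ∈ T from h)]
    · rw [Set.indicator_of_notMem (show s ∉ Set.Ioi _ from h),
        Set.indicator_of_notMem (show (ζ, s) ∉ T from h)]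
  have hTm : Measurable (T.indicator fun p => ENNReal.ofReal (Real.exp (-p.2))) :=
    Measurable.indicator (by fun_prop) hT
  have h2 : ∫⁻ ζ : Fin n → ℂ, q ζ * ENNReal.ofReal (Real.exp (-∑ i, ‖ζ i‖ ^ 2)) =
      ∫⁻ s : ℝ, ∫⁻ ζ, q ζ * T.indicator (fun p => ENNReal.ofReal (Real.exp (-p.2))) (ζ, s) := by
    rw [← lintegral_lintegral_swap
      (((hqm.comp measurable_fst).mul hTm).aemeasurable)]
    refine lintegral_congr fun ζ => ?_
    rw [h1]
    exact (lintegral_const_mul _ (hTm.comp measurable_prodMk_left)).symm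
  -- The ball is empty for s ≤ 0. The exponent is left as N + 1 - 1, with N = n + ∑ a i, to match
  -- the Gamma integral for N!.
  have h3 : ∀ s : ℝ, ∫⁻ ζ, q ζ * T.indicator (fun p => ENNReal.ofReal (Real.exp (-p.2))) (ζ, s) =
      (Set.Ioi (0 : ℝ)).indicator
        (fun s => ENNReal.ofReal (Real.exp (-s) * s ^ (((n + ∑ i, a i : ℕ) : ℝ) + 1 - 1))) s *
        J := by
    intro s
    have hms : MeasurableSet {ζ : Fin n → ℂ | ∑ i, ‖ζ i‖ ^ 2 < s} :=
      (isOpen_lt (by fun_prop) continuous_const).measurableSet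
    have e1 : ∀ ζ, q ζ * T.indicator (fun p => ENNReal.ofReal (Real.exp (-p.2))) (ζ, s) =
        ENNReal.ofReal (Real.exp (-s)) * {ζ : Fin n → ℂ | ∑ i, ‖ζ i‖ ^ 2 < s}.indicator q ζ := by
      intro ζ
      by_cases h : ∑ i, ‖ζ i‖ ^ 2 < s
      · rw [Set.indicator_of_mem (show (ζ, s) ∈ T from h),
          Set.indicator_of_mem (show ζ ∈ {ζ : Fin n → ℂ | ∑ i, ‖ζ i‖ ^ 2 < s} from h), mul_comm]
      · rw [Set.indicator_of_notMem (show (ζ, s) ∉ T from h),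
          Set.indicator_of_notMem (show ζ ∉ {ζ : Fin n → ℂ | ∑ i, ‖ζ i‖ ^ 2 < s} from h),
          mul_zero, mul_zero]
    simp only [e1]
    rw [lintegral_const_mul _ (hqm.indicator hms), lintegral_indicator hms]
    rcases le_or_gt s 0 with hs | hs
    · have hempty : {ζ : Fin n → ℂ | ∑ i, ‖ζ i‖ ^ 2 < s} = ∅ := by
        refine Set.eq_empty_of_forall_notMem fun ζ hζ => ?_
        have : 0 ≤ ∑ i, ‖ζ i‖ ^ 2 := Finset.sum_nonneg fun i _ => by positivity
        exact absurd (this.trans_lt hζ) (not_lt.mpr hs)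
      rw [hempty, Set.indicator_of_notMem (show s ∉ Set.Ioi (0 : ℝ) from not_lt.mpr hs)]
      simp
    · rw [lintegral_scaled_ball_monomial a hs, Set.indicator_of_mem (Set.mem_Ioi.mpr hs),
        ← mul_assoc, ← ENNReal.ofReal_mul (Real.exp_pos _).le, add_sub_cancel_right,
        Real.rpow_natCast]
  rw [h2]
  simp only [h3]
  rw [lintegral_mul_const _ (Measurable.indicator (by fun_prop) measurableSet_Ioi),
    lintegral_indicator measurableSet_Ioi, ← ofReal_integral_eq_lintegral_ofReal
      (Real.GammaIntegral_convergent (by positivity)), ← Real.Gamma_eq_integral (by positivity),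
    Real.Gamma_nat_eq_factorial]
  exact (ae_restrict_mem measurableSet_Ioi).mono fun s hs =>
    mul_nonneg (Real.exp_pos _).le (Real.rpow_nonneg (le_of_lt hs) _)

theorem integral_coordBall_monomial_self {n : ℕ} (a : Fin n → ℕ) :
    ∫ ζ in coordBall n, (∏ i, ζ i ^ a i) * conj (∏ i, ζ i ^ a i) =
      (Real.pi ^ n * ∏ i, ((a i).factorial : ℂ)) / (n + ∑ i, a i).factorial := by
  have h1 : ∀ ζ : Fin n → ℂ, (∏ i, ζ i ^ a i) * conj (∏ i, ζ i ^ a i) =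
      ((∏ i, ‖ζ i‖ ^ (2 * a i) : ℝ) : ℂ) := by
    intro ζ
    rw [Complex.mul_conj, Complex.normSq_eq_norm_sq, norm_prod, ← Finset.prod_pow]
    simp [← pow_mul, mul_comm]
  simp only [h1]
  have h2 : ∫ ζ in coordBall n, ∏ i, ‖ζ i‖ ^ (2 * a i) =
      (Real.pi ^ n * ∏ i, ((a i).factorial : ℝ)) / (n + ∑ i, a i).factorial := by
    rw [integral_eq_lintegral_of_nonneg_ae
      (Filter.Eventually.of_forall fun ζ => Finset.prod_nonneg fun i _ => by positivity)
      (Continuous.aestronglyMeasurable (by fun_prop)), eq_div_iff (by positivity), mul_comm]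
    have h3 := congrArg ENNReal.toReal (lintegral_coordBall_monomial a)
    rw [ENNReal.toReal_mul, ENNReal.toReal_ofReal (by positivity),
      ENNReal.toReal_ofReal (by positivity)] at h3
    exact h3
  rw [integral_complex_ofReal, h2]
  push_cast
  rfl

end BallIntegrals

/-! ### The reproducing formula and multipliers of the Bergman space -/

section ReproducingFormula

open ComplexConjugate MeasureTheory

open scoped InnerProductSpace

theorem integrableOn_coordBall_of_bounded {n : ℕ} {G : EuclideanSpace ℂ (Fin n) → ℂ}
    (hG : ContinuousOn G (Metric.ball 0 1)) {M : ℝ}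
    (hM : ∀ z ∈ Metric.ball (0 : EuclideanSpace ℂ (Fin n)) 1, ‖G z‖ ≤ M) :
    IntegrableOn (fun ζ => G (WithLp.toLp 2 ζ)) (coordBall n) := by
  have hc : ContinuousOn (fun ζ : Fin n → ℂ => G (WithLp.toLp 2 ζ)) (coordBall n) :=
    hG.comp (PiLp.continuous_toLp 2 _).continuousOn fun ζ hζ => mem_coordBall_iff.mp hζ
  refine Integrable.of_bound (hc.aestronglyMeasurable (isOpen_coordBall n).measurableSet) M ?_
  exact (ae_restrict_mem (isOpen_coordBall n).measurableSet).mono fun ζ hζ =>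
    hM _ (mem_coordBall_iff.mp hζ)

theorem one_sub_norm_le_norm_one_sub_inner {n : ℕ} {z ζ : EuclideanSpace ℂ (Fin n)}
    (hζ : ζ ∈ Metric.ball (0 : EuclideanSpace ℂ (Fin n)) 1) :
    1 - ‖z‖ ≤ ‖1 - ⟪ζ, z⟫_ℂ‖ := by
  have h1 := norm_inner_le_norm (𝕜 := ℂ) ζ z
  have h2 := norm_sub_norm_le (1 : ℂ) ⟪ζ, z⟫_ℂ
  rw [norm_one] at h2
  nlinarith [mem_ball_zero_iff.mp hζ, norm_nonneg z]

theorem one_sub_inner_ne_zero {n : ℕ} {z ζ : EuclideanSpace ℂ (Fin n)}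
    (hz : z ∈ Metric.ball (0 : EuclideanSpace ℂ (Fin n)) 1)
    (hζ : ζ ∈ Metric.ball (0 : EuclideanSpace ℂ (Fin n)) 1) : 1 - ⟪ζ, z⟫_ℂ ≠ 0 :=
  norm_pos_iff.mp ((sub_pos.mpr (mem_ball_zero_iff.mp hz)).trans_le
    (one_sub_norm_le_norm_one_sub_inner hζ))

theorem norm_kernel_le {n : ℕ} (k : ℕ) {z ζ : EuclideanSpace ℂ (Fin n)}
    (hz : z ∈ Metric.ball (0 : EuclideanSpace ℂ (Fin n)) 1)
    (hζ : ζ ∈ Metric.ball (0 : EuclideanSpace ℂ (Fin n)) 1) :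
    ‖1 / (1 - ⟪ζ, z⟫_ℂ) ^ k‖ ≤ 1 / (1 - ‖z‖) ^ k := by
  have h0 : 0 < 1 - ‖z‖ := sub_pos.mpr (mem_ball_zero_iff.mp hz)
  rw [norm_div, norm_one, norm_pow]
  exact one_div_le_one_div_of_le (by positivity)
    (pow_le_pow_left₀ h0.le (one_sub_norm_le_norm_one_sub_inner hζ) _)

theorem continuousOn_kernel {n : ℕ} (k : ℕ) {z : EuclideanSpace ℂ (Fin n)}
    (hz : z ∈ Metric.ball (0 : EuclideanSpace ℂ (Fin n)) 1) :
    ContinuousOn (fun ζ : EuclideanSpace ℂ (Fin n) => 1 / (1 - ⟪ζ, z⟫_ℂ) ^ k)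
      (Metric.ball 0 1) := by
  refine continuousOn_const.div (Continuous.continuousOn (by fun_prop)) fun ζ hζ => ?_
  exact pow_ne_zero _ (one_sub_inner_ne_zero hz hζ)

/-- In the multinomial expansion of the power of the inner product, orthogonality leaves only the
exponent `a`, and its moment cancels the multinomial and binomial coefficients. -/
theorem integral_monomial_mul_inner_pow {n : ℕ} (a : Fin n → ℕ) (z : EuclideanSpace ℂ (Fin n))
    (l : ℕ) :
    ∫ ζ in coordBall n, (∏ i, ζ i ^ a i) *
      (((l + n).choose n : ℂ) * ⟪(WithLp.toLp 2 ζ : EuclideanSpace ℂ (Fin n)), z⟫_ℂ ^ l) =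
      if l = ∑ i, a i then (Real.pi ^ n / n.factorial : ℂ) * ∏ i, z i ^ a i else 0 := by
  have h1 : ∀ ζ : Fin n → ℂ, (∏ i, ζ i ^ a i) *
      (((l + n).choose n : ℂ) * ⟪(WithLp.toLp 2 ζ : EuclideanSpace ℂ (Fin n)), z⟫_ℂ ^ l) =
      ∑ k ∈ Finset.piAntidiag Finset.univ l, (((l + n).choose n : ℂ) *
        Nat.multinomial Finset.univ k * ∏ i, z i ^ k i) *
        ((∏ i, ζ i ^ a i) * conj (∏ i, ζ i ^ k i)) := by
    intro ζ
    rw [PiLp.inner_apply]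
    simp only [RCLike.inner_apply]
    rw [Finset.sum_pow_eq_sum_piAntidiag, Finset.mul_sum, Finset.mul_sum]
    refine Finset.sum_congr rfl fun k _ => ?_
    simp only [mul_pow, Finset.prod_mul_distrib, map_prod, map_pow]
    ring
  have hint : ∀ k : Fin n → ℕ, IntegrableOn
      (fun ζ : Fin n → ℂ => (∏ i, ζ i ^ a i) * conj (∏ i, ζ i ^ k i)) (coordBall n) := by
    intro k
    have hc : Continuous fun ζ : Fin n → ℂ => (∏ i, ζ i ^ a i) * conj (∏ i, ζ i ^ k i) := by
      fun_prop
    refine (hc.continuousOn.integrableOn_compact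
      (isCompact_closedBall (0 : Fin n → ℂ) 1)).mono_set fun ζ hζ => ?_
    rw [mem_closedBall_zero_iff, pi_norm_le_iff_of_nonneg zero_le_one]
    exact fun i => (norm_apply_lt_one_of_mem_coordBall hζ i).le
  simp only [h1]
  rw [integral_finsetSum _ fun k _ => (hint k).const_mul _]
  simp only [integral_const_mul]
  have h2 : ∀ k ∈ Finset.piAntidiag (Finset.univ : Finset (Fin n)) l, k ≠ a →
      (((l + n).choose n : ℂ) * Nat.multinomial Finset.univ k * ∏ i, z i ^ k i) *
        ∫ ζ in coordBall n, (∏ i, ζ i ^ a i) * conj (∏ i, ζ i ^ k i) = 0 := fun k _ hk => by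
    rw [integral_coordBall_monomial_of_ne hk.symm, mul_zero]
  split_ifs with hl
  · rw [Finset.sum_eq_single a h2 (fun h => (h (by simp [hl])).elim),
      integral_coordBall_monomial_self]
    have hm : (∏ i, ((a i).factorial : ℂ)) * Nat.multinomial Finset.univ a =
        (l.factorial : ℂ) := by
      rw [hl]
      exact_mod_cast Nat.multinomial_spec Finset.univ a
    have hch : ((l + n).choose n : ℂ) * l.factorial * n.factorial = (n + l).factorial := by
      rw [add_comm n l]
      have := Nat.add_choose_mul_factorial_mul_factorial l n
      exact_mod_cast this
    rw [← hl]
    have e1 : ((n + l).factorial : ℂ) ≠ 0 := by exact_mod_cast Nat.factorial_ne_zero _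
    have e2 : (n.factorial : ℂ) ≠ 0 := by exact_mod_cast Nat.factorial_ne_zero _
    rw [mul_div_assoc', div_mul_eq_mul_div, div_eq_div_iff e1 e2, ← hch, ← hm]
    ring
  · refine Finset.sum_eq_zero fun k hk => h2 k hk ?_
    rintro rfl
    rw [Finset.mem_piAntidiag] at hk
    exact hl hk.1.symm

/-- The reproducing formula on the ball, for monomials. -/
theorem integral_monomial_mul_kernel {n : ℕ} (a : Fin n → ℕ) {z : EuclideanSpace ℂ (Fin n)}
    (hz : z ∈ Metric.ball (0 : EuclideanSpace ℂ (Fin n)) 1) :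
    ∫ ζ in coordBall n, (∏ i, ζ i ^ a i) *
      (1 / (1 - ⟪(WithLp.toLp 2 ζ : EuclideanSpace ℂ (Fin n)), z⟫_ℂ) ^ (n + 1)) =
      (Real.pi ^ n / n.factorial : ℂ) * ∏ i, z i ^ a i := by
  have hz' : ‖z‖ < 1 := mem_ball_zero_iff.mp hz
  have hB := (isOpen_coordBall n).measurableSet
  have hin : ∀ ζ ∈ coordBall n,
      ‖⟪(WithLp.toLp 2 ζ : EuclideanSpace ℂ (Fin n)), z⟫_ℂ‖ ≤ ‖z‖ := fun ζ hζ => by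
    have h1 := norm_inner_le_norm (𝕜 := ℂ) (WithLp.toLp 2 ζ : EuclideanSpace ℂ (Fin n)) z
    nlinarith [mem_ball_zero_iff.mp (mem_coordBall_iff.mp hζ), norm_nonneg z]
  have hsum : Summable fun l : ℕ => ((l + n).choose n : ℝ) * ‖z‖ ^ l :=
    (hasSum_choose_mul_geometric_of_norm_lt_one n (by simpa using hz')).summable
  have h := hasSum_integral_of_dominated_convergence (μ := volume.restrict (coordBall n))
    (F := fun (l : ℕ) ζ => (∏ i, ζ i ^ a i) *
      (((l + n).choose n : ℂ) * ⟪(WithLp.toLp 2 ζ : EuclideanSpace ℂ (Fin n)), z⟫_ℂ ^ l))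
    (f := fun ζ => (∏ i, ζ i ^ a i) *
      (1 / (1 - ⟪(WithLp.toLp 2 ζ : EuclideanSpace ℂ (Fin n)), z⟫_ℂ) ^ (n + 1)))
    (fun l _ => ((l + n).choose n : ℝ) * ‖z‖ ^ l)
    (fun l => Continuous.aestronglyMeasurable (by fun_prop))
    (fun l => (ae_restrict_mem hB).mono fun ζ hζ => by
      have h1 : ‖∏ i, ζ i ^ a i‖ ≤ 1 := by
        rw [norm_prod]
        refine Finset.prod_le_one (fun i _ => norm_nonneg _) fun i _ => ?_
        rw [norm_pow]
        exact pow_le_one₀ (norm_nonneg _) (norm_apply_lt_one_of_mem_coordBall hζ i).le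
      rw [norm_mul, norm_mul, norm_pow, Complex.norm_natCast]
      have h2 := pow_le_pow_left₀ (norm_nonneg _) (hin ζ hζ) l
      calc _ ≤ 1 * (((l + n).choose n : ℝ) * ‖z‖ ^ l) := by gcongr
        _ = _ := one_mul _)
    (Filter.Eventually.of_forall fun _ => hsum) (integrable_const _)
    ((ae_restrict_mem hB).mono fun ζ hζ =>
      (hasSum_choose_mul_geometric_of_norm_lt_one n ((hin ζ hζ).trans_lt hz')).mul_left _)
  simp only [integral_monomial_mul_inner_pow] at h
  exact h.unique (hasSum_ite_eq _ _)

/-- Counting letters turns each word into a monomial, so the monomial formula extends by linearity.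
-/
theorem integral_wordPower_mul_kernel {n m : ℕ} (u : EuclideanSpace ℂ (Fin m → Fin n))
    {z : EuclideanSpace ℂ (Fin n)} (hz : z ∈ Metric.ball (0 : EuclideanSpace ℂ (Fin n)) 1) :
    ∫ ζ in coordBall n, ⟪wordPower m (WithLp.toLp 2 ζ : EuclideanSpace ℂ (Fin n)), u⟫_ℂ *
      (1 / (1 - ⟪(WithLp.toLp 2 ζ : EuclideanSpace ℂ (Fin n)), z⟫_ℂ) ^ (n + 1)) =
      (Real.pi ^ n / n.factorial : ℂ) * ⟪wordPower m z, u⟫_ℂ := by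
  have h0 : ∀ (w : Fin m → Fin n) (x : Fin n → ℂ),
      ∏ i, x (w i) = ∏ j, x j ^ (Finset.univ.filter fun i => w i = j).card := by
    intro w x
    rw [← Finset.prod_fiberwise' Finset.univ w x]
    simp
  have h1 : ∀ x : EuclideanSpace ℂ (Fin n), ⟪wordPower m x, u⟫_ℂ =
      ∑ w : Fin m → Fin n, u w * ∏ j, x j ^ (Finset.univ.filter fun i => w i = j).card := by
    intro x
    simp only [wordPower, PiLp.inner_apply, RCLike.inner_apply, Complex.conj_conj, h0]
  have hint : ∀ a : Fin n → ℕ, IntegrableOn (fun ζ : Fin n → ℂ => (∏ i, ζ i ^ a i) *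
      (1 / (1 - ⟪(WithLp.toLp 2 ζ : EuclideanSpace ℂ (Fin n)), z⟫_ℂ) ^ (n + 1)))
      (coordBall n) := by
    intro a
    refine integrableOn_coordBall_of_bounded
      (G := fun x => (∏ i, x i ^ a i) * (1 / (1 - ⟪x, z⟫_ℂ) ^ (n + 1)))
      (M := 1 * (1 / (1 - ‖z‖) ^ (n + 1)))
      ((Continuous.continuousOn (by fun_prop)).mul (continuousOn_kernel _ hz)) fun x hx => ?_
    rw [norm_mul]
    refine mul_le_mul ?_ (norm_kernel_le _ hz hx) (norm_nonneg _) zero_le_one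
    rw [norm_prod]
    refine Finset.prod_le_one (fun i _ => norm_nonneg _) fun i _ => ?_
    rw [norm_pow]
    exact pow_le_one₀ (norm_nonneg _)
      ((PiLp.norm_apply_le x i).trans (mem_ball_zero_iff.mp hx).le)
  simp only [h1, Finset.sum_mul, mul_assoc]
  rw [integral_finsetSum _ fun w _ => (hint _).const_mul _, Finset.mul_sum]
  refine Finset.sum_congr rfl fun w _ => ?_
  rw [integral_const_mul, integral_monomial_mul_kernel _ hz]
  ring

/-- The reproducing formula of the ball, for bounded analytic functions. -/
theorem integral_mul_kernel {n : ℕ} {F : EuclideanSpace ℂ (Fin n) → ℂ}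
    (hF : AnalyticOnNhd ℂ F (Metric.ball 0 1)) {M : ℝ}
    (hM : ∀ z ∈ Metric.ball (0 : EuclideanSpace ℂ (Fin n)) 1, ‖F z‖ ≤ M)
    {z : EuclideanSpace ℂ (Fin n)} (hz : z ∈ Metric.ball (0 : EuclideanSpace ℂ (Fin n)) 1) :
    ∫ ζ in coordBall n, F (WithLp.toLp 2 ζ) *
      (1 / (1 - ⟪(WithLp.toLp 2 ζ : EuclideanSpace ℂ (Fin n)), z⟫_ℂ) ^ (n + 1)) =
      (Real.pi ^ n / n.factorial : ℂ) * F z := by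
  have hB := (isOpen_coordBall n).measurableSet
  obtain ⟨u, hu⟩ := exists_hasSum_wordPower hF hM
  set κ : EuclideanSpace ℂ (Fin n) → ℂ := fun x => 1 / (1 - ⟪x, z⟫_ℂ) ^ (n + 1) with hκ
  set K : ℝ := 1 / (1 - ‖z‖) ^ (n + 1) with hK
  have hκK : ∀ x ∈ Metric.ball (0 : EuclideanSpace ℂ (Fin n)) 1, ‖κ x‖ ≤ K :=
    fun x hx => norm_kernel_le _ hz hx
  have hM0 : 0 ≤ M := (norm_nonneg _).trans (hM z hz)
  have hscale : ∀ r ∈ Set.Ioo (0 : ℝ) 1, ∀ x ∈ Metric.ball (0 : EuclideanSpace ℂ (Fin n)) 1,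
      (r : ℂ) • x ∈ Metric.ball (0 : EuclideanSpace ℂ (Fin n)) 1 := by
    intro r hr x hx
    rw [mem_ball_zero_iff] at hx ⊢
    rw [norm_smul, Complex.norm_real, Real.norm_of_nonneg hr.1.le]
    nlinarith [norm_nonneg x, hr.1, hr.2]
  have hmeas : ∀ G : EuclideanSpace ℂ (Fin n) → ℂ, ContinuousOn G (Metric.ball 0 1) →
      AEStronglyMeasurable (fun ζ : Fin n → ℂ => G (WithLp.toLp 2 ζ) * κ (WithLp.toLp 2 ζ))
        (volume.restrict (coordBall n)) := fun G hG => by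
    have hc : ContinuousOn (fun ζ : Fin n → ℂ => G (WithLp.toLp 2 ζ) * κ (WithLp.toLp 2 ζ))
        (coordBall n) :=
      (hG.mul (continuousOn_kernel _ hz)).comp (PiLp.continuous_toLp 2 _).continuousOn
        fun ζ hζ => mem_coordBall_iff.mp hζ
    exact hc.aestronglyMeasurable hB
  -- For the dilate F(r ·) the homogeneous parts have the summable majorant r^m M K, which the
  -- bounds for F itself do not supply. The limit r → 1 is then dominated by the constant M K.
  have hr : ∀ r ∈ Set.Ioo (0 : ℝ) 1, ∫ ζ in coordBall n,
      F ((r : ℂ) • WithLp.toLp 2 ζ) * κ (WithLp.toLp 2 ζ) =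
      (Real.pi ^ n / n.factorial : ℂ) * F ((r : ℂ) • z) := by
    intro r hr
    have h := hasSum_integral_of_dominated_convergence (μ := volume.restrict (coordBall n))
      (F := fun (m : ℕ) ζ =>
        ((r : ℂ) ^ m * ⟪wordPower m (WithLp.toLp 2 ζ : EuclideanSpace ℂ (Fin n)), u m⟫_ℂ) *
          κ (WithLp.toLp 2 ζ))
      (f := fun ζ => F ((r : ℂ) • WithLp.toLp 2 ζ) * κ (WithLp.toLp 2 ζ))
      (fun m _ => r ^ m * (M * K))
      (fun m => hmeas (fun x => (r : ℂ) ^ m * ⟪wordPower m x, u m⟫_ℂ) (by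
        simp only [wordPower, PiLp.inner_apply, RCLike.inner_apply, Complex.conj_conj]
        exact Continuous.continuousOn (by fun_prop)))
      (fun m => (ae_restrict_mem hB).mono fun ζ hζ => by
        have hζ' := mem_coordBall_iff.mp hζ
        rw [norm_mul, norm_mul, norm_pow, Complex.norm_real, Real.norm_of_nonneg hr.1.le,
          mul_assoc]
        exact mul_le_mul_of_nonneg_left
          (mul_le_mul ((hu _ hζ').1 m) (hκK _ hζ') (norm_nonneg _) hM0) (pow_nonneg hr.1.le _))
      (Filter.Eventually.of_forall fun _ =>
        (summable_geometric_of_lt_one hr.1.le hr.2).mul_right _) (integrable_const _)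
      ((ae_restrict_mem hB).mono fun ζ hζ => by
        have h1 := (hu _ (hscale r hr _ (mem_coordBall_iff.mp hζ))).2
        simp only [inner_wordPower_smul] at h1
        exact h1.mul_right _)
    simp only [mul_assoc, integral_const_mul] at h
    have h2 : ∀ m : ℕ, ∫ ζ in coordBall n,
        ⟪wordPower m (WithLp.toLp 2 ζ : EuclideanSpace ℂ (Fin n)), u m⟫_ℂ * κ (WithLp.toLp 2 ζ) =
        (Real.pi ^ n / n.factorial : ℂ) * ⟪wordPower m z, u m⟫_ℂ :=
      fun m => integral_wordPower_mul_kernel (u m) hz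
    simp only [h2] at h
    refine h.unique ?_
    have h3 := ((hu _ (hscale r hr _ hz)).2).mul_left (Real.pi ^ n / n.factorial : ℂ)
    simp only [inner_wordPower_smul] at h3
    refine (funext fun m => ?_ : (fun m => _) = fun m => _) ▸ h3
    ring
  have hev : ∀ᶠ r : ℝ in nhdsWithin 1 (Set.Iio 1), r ∈ Set.Ioo (0 : ℝ) 1 :=
    Ioo_mem_nhdsLT one_pos
  have hlim : ∀ x ∈ Metric.ball (0 : EuclideanSpace ℂ (Fin n)) 1, Filter.Tendsto
      (fun r : ℝ => F ((r : ℂ) • x)) (nhdsWithin 1 (Set.Iio 1)) (nhds (F x)) := by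
    intro x hx
    have h1 : Filter.Tendsto (fun r : ℝ => (r : ℂ) • x) (nhds 1) (nhds x) := by
      have : Continuous fun r : ℝ => (r : ℂ) • x := by fun_prop
      simpa using this.tendsto 1
    exact ((hF x hx).continuousAt.tendsto.comp h1).mono_left nhdsWithin_le_nhds
  have hL := tendsto_integral_filter_of_dominated_convergence
    (μ := volume.restrict (coordBall n)) (l := nhdsWithin (1 : ℝ) (Set.Iio 1))
    (F := fun (r : ℝ) ζ => F ((r : ℂ) • WithLp.toLp 2 ζ) * κ (WithLp.toLp 2 ζ))
    (f := fun ζ => F (WithLp.toLp 2 ζ) * κ (WithLp.toLp 2 ζ)) (fun _ => M * K)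
    (hev.mono fun r hr => hmeas (fun x => F ((r : ℂ) • x))
      (hF.continuousOn.comp (by fun_prop) fun x hx => hscale r hr x hx))
    (hev.mono fun r hr => (ae_restrict_mem hB).mono fun ζ hζ => by
      rw [norm_mul]
      exact mul_le_mul (hM _ (hscale r hr _ (mem_coordBall_iff.mp hζ)))
        (hκK _ (mem_coordBall_iff.mp hζ)) (norm_nonneg _) hM0)
    (integrable_const _)
    ((ae_restrict_mem hB).mono fun ζ hζ => (hlim _ (mem_coordBall_iff.mp hζ)).mul_const _)
  refine tendsto_nhds_unique hL (((hlim z hz).const_mul _).congr' ?_)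
  exact hev.mono fun r hr' => (hr r hr').symm

/-- Finite linear combinations of the kernel functions `(1 - ⟨·, x⟩) ^ (-(n + 1))`. -/
noncomputable def kernelSum (n : ℕ) (s : Finset (Metric.ball (0 : EuclideanSpace ℂ (Fin n)) 1))
    (a : Metric.ball (0 : EuclideanSpace ℂ (Fin n)) 1 → ℂ) (z : EuclideanSpace ℂ (Fin n)) : ℂ :=
  ∑ x ∈ s, a x * (1 / (1 - ⟪(x : EuclideanSpace ℂ (Fin n)), z⟫_ℂ) ^ (n + 1))

theorem kernelSum_eq_inner {n : ℕ} (s : Finset (Metric.ball (0 : EuclideanSpace ℂ (Fin n)) 1))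
    (a : Metric.ball (0 : EuclideanSpace ℂ (Fin n)) 1 → ℂ)
    (z : Metric.ball (0 : EuclideanSpace ℂ (Fin n)) 1) :
    kernelSum n s a z = ⟪wordFeature n n z, ∑ x ∈ s, a x • wordFeature n n x⟫_ℂ := by
  simp only [kernelSum, inner_sum, inner_smul_right, inner_wordFeature]

theorem analyticOnNhd_kernelSum {n : ℕ}
    (s : Finset (Metric.ball (0 : EuclideanSpace ℂ (Fin n)) 1))
    (a : Metric.ball (0 : EuclideanSpace ℂ (Fin n)) 1 → ℂ) :
    AnalyticOnNhd ℂ (kernelSum n s a) (Metric.ball 0 1) :=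
  MemWeighted.analyticOnNhd (d := n) ⟨_, kernelSum_eq_inner s a⟩

theorem conj_kernelSum {n : ℕ} (s : Finset (Metric.ball (0 : EuclideanSpace ℂ (Fin n)) 1))
    (a : Metric.ball (0 : EuclideanSpace ℂ (Fin n)) 1 → ℂ) (z : EuclideanSpace ℂ (Fin n)) :
    conj (kernelSum n s a z) =
      ∑ x ∈ s, conj (a x) * (1 / (1 - ⟪z, (x : EuclideanSpace ℂ (Fin n))⟫_ℂ) ^ (n + 1)) := by
  simp only [kernelSum, map_sum, map_mul, map_div₀, map_one, map_pow, map_sub, inner_conj_symm]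

theorem exists_norm_kernelSum_le {n : ℕ}
    (s : Finset (Metric.ball (0 : EuclideanSpace ℂ (Fin n)) 1))
    (a : Metric.ball (0 : EuclideanSpace ℂ (Fin n)) 1 → ℂ) :
    ∃ M : ℝ, ∀ z ∈ Metric.ball (0 : EuclideanSpace ℂ (Fin n)) 1, ‖kernelSum n s a z‖ ≤ M := by
  refine ⟨∑ x ∈ s, ‖a x‖ * (1 / (1 - ‖(x : EuclideanSpace ℂ (Fin n))‖) ^ (n + 1)),
    fun z hz => ?_⟩
  rw [← RCLike.norm_conj, conj_kernelSum]
  refine (norm_sum_le _ _).trans (Finset.sum_le_sum fun x _ => ?_)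
  rw [norm_mul, RCLike.norm_conj]
  exact mul_le_mul_of_nonneg_left (norm_kernel_le _ x.2 hz) (norm_nonneg _)

theorem integrableOn_mul_conj_kernelSum {n : ℕ} {F : EuclideanSpace ℂ (Fin n) → ℂ}
    (hF : ContinuousOn F (Metric.ball 0 1)) {M : ℝ}
    (hM : ∀ z ∈ Metric.ball (0 : EuclideanSpace ℂ (Fin n)) 1, ‖F z‖ ≤ M)
    (s : Finset (Metric.ball (0 : EuclideanSpace ℂ (Fin n)) 1))
    (a : Metric.ball (0 : EuclideanSpace ℂ (Fin n)) 1 → ℂ) :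
    IntegrableOn (fun ζ => F (WithLp.toLp 2 ζ) * conj (kernelSum n s a (WithLp.toLp 2 ζ)))
      (coordBall n) := by
  obtain ⟨K, hK⟩ := exists_norm_kernelSum_le s a
  refine integrableOn_coordBall_of_bounded (G := fun x => F x * conj (kernelSum n s a x))
    (M := M * K) (hF.mul (Complex.continuous_conj.comp_continuousOn
      (analyticOnNhd_kernelSum s a).continuousOn)) fun z hz => ?_
  rw [norm_mul, RCLike.norm_conj]
  exact mul_le_mul (hM z hz) (hK z hz) (norm_nonneg _) ((norm_nonneg _).trans (hM z hz))

/-- Pairing with a kernel sum evaluates F at finitely many points. This converts integrals into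
inner products of word features without identifying the whole weighted space with an L² space. -/
theorem integral_mul_conj_kernelSum {n : ℕ} {F : EuclideanSpace ℂ (Fin n) → ℂ}
    (hF : AnalyticOnNhd ℂ F (Metric.ball 0 1)) {M : ℝ}
    (hM : ∀ z ∈ Metric.ball (0 : EuclideanSpace ℂ (Fin n)) 1, ‖F z‖ ≤ M)
    (s : Finset (Metric.ball (0 : EuclideanSpace ℂ (Fin n)) 1))
    (a : Metric.ball (0 : EuclideanSpace ℂ (Fin n)) 1 → ℂ) :
    ∫ ζ in coordBall n, F (WithLp.toLp 2 ζ) * conj (kernelSum n s a (WithLp.toLp 2 ζ)) =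
      (Real.pi ^ n / n.factorial : ℂ) * ∑ x ∈ s, conj (a x) * F x := by
  have hint : ∀ x ∈ s, IntegrableOn (fun ζ : Fin n → ℂ => F (WithLp.toLp 2 ζ) *
      (1 / (1 - ⟪(WithLp.toLp 2 ζ : EuclideanSpace ℂ (Fin n)), (x : EuclideanSpace ℂ (Fin n))⟫_ℂ) ^
        (n + 1))) (coordBall n) := fun x _ => by
    refine integrableOn_coordBall_of_bounded
      (G := fun y => F y * (1 / (1 - ⟪y, (x : EuclideanSpace ℂ (Fin n))⟫_ℂ) ^ (n + 1)))
      (M := M * (1 / (1 - ‖(x : EuclideanSpace ℂ (Fin n))‖) ^ (n + 1)))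
      (hF.continuousOn.mul (continuousOn_kernel _ x.2)) fun y hy => ?_
    rw [norm_mul]
    exact mul_le_mul (hM y hy) (norm_kernel_le _ x.2 hy) (norm_nonneg _)
      ((norm_nonneg _).trans (hM y hy))
  have h1 : ∀ ζ : Fin n → ℂ, F (WithLp.toLp 2 ζ) * conj (kernelSum n s a (WithLp.toLp 2 ζ)) =
      ∑ x ∈ s, conj (a x) * (F (WithLp.toLp 2 ζ) *
        (1 / (1 - ⟪(WithLp.toLp 2 ζ : EuclideanSpace ℂ (Fin n)),
          (x : EuclideanSpace ℂ (Fin n))⟫_ℂ) ^ (n + 1))) := fun ζ => by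
    rw [conj_kernelSum, Finset.mul_sum]
    exact Finset.sum_congr rfl fun x _ => by ring
  simp only [h1]
  rw [integral_finsetSum _ fun x hx => (hint x hx).const_mul _, Finset.mul_sum]
  refine Finset.sum_congr rfl fun x _ => ?_
  rw [integral_const_mul, integral_mul_kernel hF hM x.2]
  ring

/-- Bounded analytic functions multiply the Bergman space of the ball. -/
theorem isWeightedMultiplier_of_bounded {n : ℕ} {φ : EuclideanSpace ℂ (Fin n) → ℂ}
    (hφ : AnalyticOnNhd ℂ φ (Metric.ball 0 1)) {M : ℝ}
    (hM : ∀ z ∈ Metric.ball (0 : EuclideanSpace ℂ (Fin n)) 1, ‖φ z‖ ≤ M) :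
    IsWeightedMultiplier n n φ := by
  rw [isWeightedMultiplier_iff]
  have hM0 : 0 ≤ M := (norm_nonneg _).trans (hM 0 (by simp))
  refine ⟨M, fun c => ?_⟩
  -- `v'` is the image of `v` under the formal adjoint of multiplication by φ; `G` and `H` are the
  -- functions represented by `v` and `v'`.
  set b : Metric.ball (0 : EuclideanSpace ℂ (Fin n)) 1 → ℂ := fun x => c x * conj (φ x) with hb
  set v : WordSpace n := ∑ x ∈ c.support, c x • wordFeature n n x with hv
  set v' : WordSpace n := ∑ x ∈ c.support, b x • wordFeature n n x with hv'
  have hv1 : Finsupp.linearCombination ℂ (wordFeature n n) c = v := by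
    simp [Finsupp.linearCombination_apply, Finsupp.sum, hv]
  have hv1' : Finsupp.linearCombination ℂ (fun x : Metric.ball (0 : EuclideanSpace ℂ (Fin n)) 1 =>
      conj (φ x) • wordFeature n n x) c = v' := by
    simp [Finsupp.linearCombination_apply, Finsupp.sum, hv', hb, smul_smul]
  rw [hv1, hv1']
  set G := kernelSum n c.support c with hG
  set H := kernelSum n c.support b with hH
  obtain ⟨K, hK⟩ := exists_norm_kernelSum_le c.support c
  obtain ⟨L, hL⟩ := exists_norm_kernelSum_le c.support b
  have hGa := analyticOnNhd_kernelSum c.support c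
  have hHa := analyticOnNhd_kernelSum c.support b
  have hφH : ∀ z ∈ Metric.ball (0 : EuclideanSpace ℂ (Fin n)) 1, ‖φ z * H z‖ ≤ M * L :=
    fun z hz => by
      rw [norm_mul]
      exact mul_le_mul (hM z hz) (hL z hz) (norm_nonneg _) hM0
  set C₀ : ℂ := Real.pi ^ n / n.factorial with hC₀
  have hpair : ∀ a a' : Metric.ball (0 : EuclideanSpace ℂ (Fin n)) 1 → ℂ,
      ∑ x ∈ c.support, conj (a x) * kernelSum n c.support a' x =
        ⟪∑ x ∈ c.support, a x • wordFeature n n x,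
          ∑ x ∈ c.support, a' x • wordFeature n n x⟫_ℂ := fun a a' => by
    simp only [sum_inner, inner_smul_left, kernelSum_eq_inner]
  have I1 := integral_mul_conj_kernelSum hGa hK c.support c
  have I2 := integral_mul_conj_kernelSum hHa hL c.support b
  have I3 := integral_mul_conj_kernelSum (hφ.mul hHa) hφH c.support c
  have J1 := integrableOn_mul_conj_kernelSum hGa.continuousOn hK c.support c
  have J2 := integrableOn_mul_conj_kernelSum hHa.continuousOn hL c.support b
  have J3 := integrableOn_mul_conj_kernelSum (hφ.mul hHa).continuousOn hφH c.support c
  rw [hpair, ← hv, inner_self_eq_norm_sq_to_K] at I1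
  rw [hpair, ← hv', inner_self_eq_norm_sq_to_K] at I2
  -- The adjoint relation: pairing φH with G is the same as pairing H with itself.
  have hI3 : ∑ x ∈ c.support, conj (c x) * ((φ * H) x) = (‖v'‖ : ℂ) ^ 2 := by
    have h1 := hpair b b
    rw [← hv', inner_self_eq_norm_sq_to_K] at h1
    refine Eq.trans (Finset.sum_congr rfl fun x _ => ?_) h1
    simp only [hb, hH, Pi.mul_apply, map_mul, Complex.conj_conj]
    ring
  have I3' : ∫ ζ in coordBall n, φ (WithLp.toLp 2 ζ) * kernelSum n c.support b (WithLp.toLp 2 ζ) *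
      conj (kernelSum n c.support c (WithLp.toLp 2 ζ)) = C₀ * (‖v'‖ : ℂ) ^ 2 := by
    rw [← hI3]
    exact I3
  -- A completed square in place of Cauchy–Schwarz: |φ| ≤ M gives Re W ≥ (M|G| - |H|)² ≥ 0
  -- pointwise, while the integral of `W` is `C₀` times M²‖v‖² - ‖v'‖².
  let W : (Fin n → ℂ) → ℂ := fun ζ =>
    (M ^ 2 : ℂ) * (G (WithLp.toLp 2 ζ) * conj (kernelSum n c.support c (WithLp.toLp 2 ζ))) -
      2 * ((φ * H) (WithLp.toLp 2 ζ) * conj (kernelSum n c.support c (WithLp.toLp 2 ζ))) +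
      H (WithLp.toLp 2 ζ) * conj (kernelSum n c.support b (WithLp.toLp 2 ζ))
  have hWi : IntegrableOn W (coordBall n) :=
    ((J1.const_mul _).sub (J3.const_mul _)).add J2
  have hWI : ∫ ζ in coordBall n, W ζ =
      (M ^ 2 : ℂ) * (C₀ * (‖v‖ : ℂ) ^ 2) - 2 * (C₀ * (‖v'‖ : ℂ) ^ 2) + C₀ * (‖v'‖ : ℂ) ^ 2 := by
    have e1 := integral_add ((J1.const_mul (M ^ 2 : ℂ)).sub (J3.const_mul 2)) J2
    have e2 := integral_sub (J1.const_mul (M ^ 2 : ℂ)) (J3.const_mul 2)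
    refine (e1.trans (congrArg (fun t => t + _) e2)).trans ?_
    rw [integral_const_mul, integral_const_mul, I1, I2]
    exact congrArg (fun t => _ - 2 * t + _) I3'
  have hWre : ∀ ζ ∈ coordBall n, 0 ≤ (W ζ).re := by
    intro ζ hζ
    have hφζ := hM _ (mem_coordBall_iff.mp hζ)
    set g := G (WithLp.toLp 2 ζ)
    set h := H (WithLp.toLp 2 ζ)
    have e1 : W ζ = ((M ^ 2 * ‖g‖ ^ 2 + ‖h‖ ^ 2 : ℝ) : ℂ) -
        2 * (φ (WithLp.toLp 2 ζ) * h * conj g) := by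
      change (M ^ 2 : ℂ) * (g * conj g) - 2 * (φ (WithLp.toLp 2 ζ) * h * conj g) + h * conj h = _
      rw [Complex.mul_conj, Complex.mul_conj, Complex.normSq_eq_norm_sq, Complex.normSq_eq_norm_sq]
      push_cast
      ring
    have e2 : (φ (WithLp.toLp 2 ζ) * h * conj g).re ≤ M * ‖h‖ * ‖g‖ := by
      refine (Complex.re_le_norm _).trans ?_
      rw [norm_mul, norm_mul, RCLike.norm_conj]
      gcongr
    rw [e1, Complex.sub_re, Complex.ofReal_re, Complex.mul_re]
    simp only [Complex.re_ofNat, Complex.im_ofNat, zero_mul, sub_zero]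
    nlinarith [sq_nonneg (M * ‖g‖ - ‖h‖)]
  have hpos : 0 ≤ (∫ ζ in coordBall n, W ζ).re := by
    have e1 : ∫ ζ in coordBall n, RCLike.re (W ζ) = RCLike.re (∫ ζ in coordBall n, W ζ) :=
      integral_re hWi
    change 0 ≤ RCLike.re (∫ ζ in coordBall n, W ζ)
    rw [← e1]
    exact setIntegral_nonneg (isOpen_coordBall n).measurableSet hWre
  have hval : (∫ ζ in coordBall n, W ζ) =
      (((Real.pi ^ n / n.factorial) * (M ^ 2 * ‖v‖ ^ 2 - ‖v'‖ ^ 2) : ℝ) : ℂ) := by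
    rw [hWI, hC₀]
    push_cast
    ring
  rw [hval, Complex.ofReal_re] at hpos
  have h1 : 0 ≤ M ^ 2 * ‖v‖ ^ 2 - ‖v'‖ ^ 2 :=
    nonneg_of_mul_nonneg_right hpos (by positivity)
  refine (abs_le_of_sq_le_sq' ?_ (by positivity)).2
  rw [mul_pow]
  linarith

end ReproducingFormula

/-! ### Existence of an analytic logarithm -/

section AnalyticLogarithm

/-- A nonvanishing analytic function on the ball has an analytic logarithm. -/
theorem exists_isAnalyticLog {n : ℕ} {f : EuclideanSpace ℂ (Fin n) → ℂ}
    (hf : AnalyticOnNhd ℂ f (Metric.ball 0 1))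
    (h0 : ∀ z ∈ Metric.ball (0 : EuclideanSpace ℂ (Fin n)) 1, f z ≠ 0) :
    ∃ g, IsAnalyticLog n f g := by
  set B := Metric.ball (0 : EuclideanSpace ℂ (Fin n)) 1 with hB
  have hBo : IsOpen B := Metric.isOpen_ball
  let ω : EuclideanSpace ℂ (Fin n) → EuclideanSpace ℂ (Fin n) →L[ℂ] ℂ :=
    fun z => (f z)⁻¹ • fderiv ℂ f z
  have hωd : DifferentiableOn ℂ ω B := fun z hz =>
    (((hf z hz).differentiableAt.inv (h0 z hz)).smul
      (hf z hz).fderiv.differentiableAt).differentiableWithinAt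
  have hloc : ∀ a ∈ B, AnalyticAt ℂ (fun z => Complex.log (f z / f a)) a := fun a ha => by
    refine AnalyticAt.clog ((hf a ha).div analyticAt_const (h0 a ha)) ?_
    rw [div_self (h0 a ha)]
    exact Complex.one_mem_slitPlane
  -- The form ω = df/f is closed: near a it is the differential of the principal logarithm of
  -- f/f(a), so its derivative is a symmetric second derivative. The real derivative is the one used
  -- by the Poincaré lemma.
  have hsymm : ∀ a ∈ B, ∀ x y, fderiv ℝ ω a x y = fderiv ℝ ω a y x := by
    intro a ha x y
    have h1 : ω =ᶠ[nhds a] fderiv ℂ (fun z => Complex.log (f z / f a)) := by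
      have h2 : ∀ᶠ z in nhds a, f z / f a ∈ Complex.slitPlane := by
        have hc : ContinuousAt (fun z => f z / f a) a := (hf a ha).continuousAt.div_const _
        refine hc.eventually_mem (Complex.isOpen_slitPlane.mem_nhds ?_)
        rw [div_self (h0 a ha)]
        exact Complex.one_mem_slitPlane
      filter_upwards [h2, hBo.mem_nhds ha] with z hz hzB
      have h3 : HasFDerivAt (fun z => f z / f a) ((f a)⁻¹ • fderiv ℂ f z) z := by
        simpa only [div_eq_inv_mul] using
          (hf z hzB).differentiableAt.hasFDerivAt.const_mul (f a)⁻¹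
      rw [(h3.clog hz).fderiv, smul_smul]
      have e1 := h0 z hzB
      have e2 := h0 a ha
      have e3 : (f z / f a)⁻¹ * (f a)⁻¹ = (f z)⁻¹ := by field_simp
      rw [e3]
    have h2 : fderiv ℝ ω a x = fderiv ℂ ω a x := by
      rw [((hωd a ha).differentiableAt (hBo.mem_nhds ha)).fderiv_restrictScalars ℝ]
      rfl
    have h3 : fderiv ℝ ω a y = fderiv ℂ ω a y := by
      rw [((hωd a ha).differentiableAt (hBo.mem_nhds ha)).fderiv_restrictScalars ℝ]
      rfl
    rw [h2, h3, h1.fderiv_eq]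
    exact ((hloc a ha).contDiffAt (n := 2)).isSymmSndFDerivAt (by simp) x y
  obtain ⟨p, hp⟩ := (convex_ball (0 : EuclideanSpace ℂ (Fin n)) 1).exists_forall_hasFDerivAt_of_fderiv_symmetric
    hBo (hωd.restrictScalars ℝ) hsymm
  -- The primitive p is a logarithm up to a constant, since exp(-p) f has zero derivative; adding
  -- log c corrects it.
  have hder : ∀ z ∈ B, HasFDerivAt (fun z => Complex.exp (-p z) * f z)
      (0 : EuclideanSpace ℂ (Fin n) →L[ℂ] ℂ) z := by
    intro z hz
    have h1 := ((hp z hz).neg.cexp).mul (hf z hz).differentiableAt.hasFDerivAt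
    convert! h1 using 1
    have := h0 z hz
    ext v
    simp [ω]
    field_simp
    ring
  have h0B : (0 : EuclideanSpace ℂ (Fin n)) ∈ B := by simp [hB]
  have hconst : ∀ z ∈ B, Complex.exp (-p z) * f z = Complex.exp (-p 0) * f 0 := fun z hz =>
    hBo.is_const_of_fderiv_eq_zero (𝕜 := ℂ) (convex_ball _ _).isPreconnected
      (fun z hz => (hder z hz).differentiableAt.differentiableWithinAt)
      (fun z hz => (hder z hz).fderiv) hz h0B
  set c := Complex.exp (-p 0) * f 0 with hc
  have hc0 : c ≠ 0 := mul_ne_zero (Complex.exp_ne_zero _) (h0 0 h0B)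
  have hexp : ∀ z ∈ B, Complex.exp (p z + Complex.log c) = f z := by
    intro z hz
    rw [Complex.exp_add, Complex.exp_log hc0, ← hconst z hz, ← mul_assoc, ← Complex.exp_add,
      add_neg_cancel, Complex.exp_zero, one_mul]
  refine ⟨fun z => p z + Complex.log c, fun a ha => ?_, hexp⟩
  -- Near a, Im(p z - p a) lies in (-π, π), so the principal logarithm of f(z)/f(a) is p z - p a;
  -- analyticity is inherited from it.
  have hev : (fun z => p a + Complex.log c + Complex.log (f z / f a)) =ᶠ[nhds a]
      fun z => p z + Complex.log c := by
    have h1 : ContinuousAt (fun z => (p z - p a).im) a :=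
      Complex.continuous_im.continuousAt.comp ((hp a ha).continuousAt.sub continuousAt_const)
    have h2 : ∀ᶠ z in nhds a, (p z - p a).im ∈ Set.Ioo (-Real.pi) Real.pi := by
      refine h1.eventually_mem (isOpen_Ioo.mem_nhds ?_)
      simp [Real.pi_pos]
    filter_upwards [h2, hBo.mem_nhds ha] with z hz hzB
    rw [← hexp z hzB, ← hexp a ha, ← Complex.exp_sub, add_sub_add_right_eq_sub,
      Complex.log_exp hz.1 hz.2.le]
    ring
  exact (analyticAt_const.add (hloc a ha)).congr hev

end AnalyticLogarithm

/-! ### Descent from the Bergman range to the Drury–Arveson space -/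

theorem IsWeightedMultiplier.isDruryArvesonMultiplier {n : ℕ} {φ : EuclideanSpace ℂ (Fin n) → ℂ}
    (h : IsWeightedMultiplier n 0 φ) : IsDruryArvesonMultiplier n φ := by
  refine ⟨?_, fun F hF => ?_⟩
  · rw [memDruryArveson_iff]
    exact (h _ (memWeighted_const 1)).congr fun z _ => mul_one _
  · rw [memDruryArveson_iff] at hF ⊢
    exact h F hF

theorem IsDruryArvesonMultiplier.isWeightedMultiplier {n : ℕ}
    {φ : EuclideanSpace ℂ (Fin n) → ℂ} (h : IsDruryArvesonMultiplier n φ) (d : ℕ) :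
    IsWeightedMultiplier n d φ := by
  refine IsWeightedMultiplier.mono (d := 0) (fun F hF => ?_) (Nat.zero_le d)
  rw [← memDruryArveson_iff] at hF ⊢
  exact h.2 F hF

/-- If `R b = b' * R f` with `f` a multiplier, then `b` multiplies the space of order `d` as soon
as `b` and `b'` multiply the space of order `d + 2`. -/
theorem isWeightedMultiplier_of_radialDeriv_eq {n d : ℕ}
    {f b b' : EuclideanSpace ℂ (Fin n) → ℂ} (hf : AnalyticOnNhd ℂ f (Metric.ball 0 1))
    (hb : AnalyticOnNhd ℂ b (Metric.ball 0 1))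
    (hR : ∀ z ∈ Metric.ball (0 : EuclideanSpace ℂ (Fin n)) 1,
      radialDeriv b z = b' z * radialDeriv f z)
    (hfd : IsWeightedMultiplier n d f) (hfd2 : IsWeightedMultiplier n (d + 2) f)
    (hbd : IsWeightedMultiplier n (d + 2) b) (hbd' : IsWeightedMultiplier n (d + 2) b') :
    IsWeightedMultiplier n d b := by
  intro F hF
  have hFa := hF.analyticOnNhd
  refine memWeighted_of_radialDeriv (hb.mul hFa) ?_
  -- The product rule for fF, solved for (R f)F: no separate multiplier property of R f is needed.
  have h1 : MemWeighted n (d + 2) fun z => radialDeriv f z * F z :=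
    ((hfd F hF).radialDeriv.sub (hfd2 _ hF.radialDeriv)).congr fun z hz => by
      rw [radialDeriv_mul hf hFa hz]
      ring
  refine ((hbd' _ h1).add (hbd _ hF.radialDeriv)).congr fun z hz => ?_
  rw [radialDeriv_mul hb hFa hz, hR z hz]
  ring

theorem radialDeriv_exp_mul {n : ℕ} {g : EuclideanSpace ℂ (Fin n) → ℂ}
    (hg : AnalyticOnNhd ℂ g (Metric.ball 0 1)) (t : ℂ) {z : EuclideanSpace ℂ (Fin n)}
    (hz : z ∈ Metric.ball (0 : EuclideanSpace ℂ (Fin n)) 1) :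
    radialDeriv (fun z => Complex.exp (t * g z)) z =
      Complex.exp (t * g z) * (t * radialDeriv g z) := by
  have h := ((differentiableAt_slice hg (z := z) (a := 1) (by rwa [one_smul])).hasDerivAt.const_mul
    t).cexp.deriv
  simp only [one_smul] at h
  exact h

theorem IsAnalyticLog.radialDeriv_eq {n : ℕ} {f g : EuclideanSpace ℂ (Fin n) → ℂ}
    (hg : IsAnalyticLog n f g) {z : EuclideanSpace ℂ (Fin n)}
    (hz : z ∈ Metric.ball (0 : EuclideanSpace ℂ (Fin n)) 1) :
    radialDeriv f z = Complex.exp (g z) * radialDeriv g z := by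
  have h1 := radialDeriv_exp_mul hg.1 1 hz
  simp only [one_mul] at h1
  rw [← h1]
  refine Filter.EventuallyEq.deriv_eq ?_
  have hc : ContinuousAt (fun a : ℂ => a • z) 1 := by fun_prop
  have hmem := hc.eventually_mem (s := Metric.ball 0 1)
    (Metric.isOpen_ball.mem_nhds (by rwa [one_smul]))
  exact hmem.mono fun a ha => (hg.2 _ ha).symm

/-- Real powers of a multiplier that is bounded and bounded below are multipliers. -/
theorem IsAnalyticLog.isWeightedMultiplier_exp {n : ℕ} {f g : EuclideanSpace ℂ (Fin n) → ℂ}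
    (hg : IsAnalyticLog n f g) (hf : IsDruryArvesonMultiplier n f) {L : ℝ}
    (hL : ∀ z ∈ Metric.ball (0 : EuclideanSpace ℂ (Fin n)) 1, |(g z).re| ≤ L) (t : ℝ) (d : ℕ) :
    IsWeightedMultiplier n d (fun z => Complex.exp ((t : ℂ) * g z)) := by
  have hfa : AnalyticOnNhd ℂ f (Metric.ball 0 1) := (memDruryArveson_iff.mp hf.1).analyticOnNhd
  have ha : ∀ t : ℝ, AnalyticOnNhd ℂ (fun z => Complex.exp ((t : ℂ) * g z)) (Metric.ball 0 1) :=
    fun t z hz => (analyticAt_const.mul (hg.1 z hz)).cexp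
  have hbd : ∀ t : ℝ, IsWeightedMultiplier n n (fun z => Complex.exp ((t : ℂ) * g z)) := fun t =>
    isWeightedMultiplier_of_bounded (ha t) (M := Real.exp (|t| * L)) fun z hz => by
      rw [Complex.norm_exp, Complex.re_ofReal_mul]
      refine Real.exp_le_exp.mpr ((le_abs_self _).trans ?_)
      rw [abs_mul]
      exact mul_le_mul_of_nonneg_left (hL z hz) (abs_nonneg _)
  -- `k` descents by two lead from d + 2k ≥ n, where boundedness suffices, to `d`. The exponent is
  -- quantified inside because each descent also calls on the power t - 1.
  have key : ∀ k d : ℕ, n ≤ d + 2 * k → ∀ t : ℝ,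
      IsWeightedMultiplier n d (fun z => Complex.exp ((t : ℂ) * g z)) := by
    intro k
    induction k with
    | zero => exact fun d hd t => (hbd t).mono hd
    | succ k ih =>
      intro d hd t
      refine isWeightedMultiplier_of_radialDeriv_eq
        (b' := fun z => t * Complex.exp (((t - 1 : ℝ) : ℂ) * g z)) hfa (ha t) (fun z hz => ?_)
        (hf.isWeightedMultiplier d) (hf.isWeightedMultiplier _) (ih (d + 2) (by omega) t)
        fun F hF => ?_
      · rw [radialDeriv_exp_mul hg.1 _ hz, hg.radialDeriv_eq hz]
        have : Complex.exp ((t : ℂ) * g z) =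
            Complex.exp (((t - 1 : ℝ) : ℂ) * g z) * Complex.exp (g z) := by
          rw [← Complex.exp_add]
          push_cast
          ring_nf
        rw [this]
        ring
      · exact ((ih (d + 2) (by omega) (t - 1) F hF).const_mul t).congr fun z _ => by ring
  exact key n d (by omega) t

/-- A bounded logarithm of a multiplier is a multiplier. -/
theorem IsAnalyticLog.isWeightedMultiplier {n : ℕ} {f g : EuclideanSpace ℂ (Fin n) → ℂ}
    (hg : IsAnalyticLog n f g) (hf : IsDruryArvesonMultiplier n f) {M : ℝ}
    (hM : ∀ z ∈ Metric.ball (0 : EuclideanSpace ℂ (Fin n)) 1, ‖g z‖ ≤ M) (d : ℕ) :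
    IsWeightedMultiplier n d g := by
  have hfa : AnalyticOnNhd ℂ f (Metric.ball 0 1) := (memDruryArveson_iff.mp hf.1).analyticOnNhd
  -- Exponent -1 gives the multiplier 1/f needed in R g = (1/f) R f.
  have hexp := hg.isWeightedMultiplier_exp hf
    (fun z hz => (Complex.abs_re_le_norm _).trans (hM z hz)) (-1)
  have key : ∀ k d : ℕ, n ≤ d + 2 * k → IsWeightedMultiplier n d g := by
    intro k
    induction k with
    | zero => exact fun d hd => (isWeightedMultiplier_of_bounded hg.1 hM).mono hd
    | succ k ih =>
      intro d hd
      refine isWeightedMultiplier_of_radialDeriv_eq hfa hg.1 (fun z hz => ?_)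
        (hf.isWeightedMultiplier d) (hf.isWeightedMultiplier _) (ih (d + 2) (by omega))
        (hexp (d + 2))
      rw [hg.radialDeriv_eq hz, ← mul_assoc, ← Complex.exp_add]
      simp
  exact key n d (by omega)

theorem IsAnalyticLog.re_eq_log_norm {n : ℕ} {f g : EuclideanSpace ℂ (Fin n) → ℂ}
    (hg : IsAnalyticLog n f g) {z : EuclideanSpace ℂ (Fin n)}
    (hz : z ∈ Metric.ball (0 : EuclideanSpace ℂ (Fin n)) 1) : (g z).re = Real.log ‖f z‖ := by
  rw [← hg.2 z hz, Complex.norm_exp, Real.log_exp]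

theorem mainTheorem5 (n : ℕ) (hn : 1 ≤ n) (f : EuclideanSpace ℂ (Fin n) → ℂ)
    (hf : IsDruryArvesonMultiplier n f) :
    ((∀ z ∈ Metric.ball (0 : EuclideanSpace ℂ (Fin n)) 1, f z ≠ 0) →
      ∃ g : EuclideanSpace ℂ (Fin n) → ℂ, IsAnalyticLog n f g) ∧
    (∀ c : ℝ, 0 < c → (∀ z ∈ Metric.ball (0 : EuclideanSpace ℂ (Fin n)) 1, c ≤ ‖f z‖) →
      ∀ g : EuclideanSpace ℂ (Fin n) → ℂ, IsAnalyticLog n f g →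
        ∀ t : ℝ, IsDruryArvesonMultiplier n (fun z => Complex.exp ((t : ℂ) * g z))) ∧
    ((∀ z ∈ Metric.ball (0 : EuclideanSpace ℂ (Fin n)) 1, f z ≠ 0) →
      ∀ g : EuclideanSpace ℂ (Fin n) → ℂ, IsAnalyticLog n f g →
        (IsDruryArvesonMultiplier n g ↔
          ∃ C : ℝ, ∀ z ∈ Metric.ball (0 : EuclideanSpace ℂ (Fin n)) 1, ‖g z‖ ≤ C)) := by
  refine ⟨fun h0 => exists_isAnalyticLog (memDruryArveson_iff.mp hf.1).analyticOnNhd h0, ?_, ?_⟩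
  · intro c hc hfc g hg t
    obtain ⟨C, hC⟩ := (hf.isWeightedMultiplier 0).bounded
    -- As Re g = log |f|, the lower bound `c` and the bound `C` for the multiplier f confine it to
    -- [log c, log C].
    refine (hg.isWeightedMultiplier_exp hf (L := max |Real.log c| |Real.log C|) (fun z hz => ?_)
      t 0).isDruryArvesonMultiplier
    rw [hg.re_eq_log_norm hz]
    exact abs_le_max_abs_abs (Real.log_le_log hc (hfc z hz))
      (Real.log_le_log (hc.trans_le (hfc z hz)) (hC z hz))
  · intro _ g hg
    refine ⟨fun h => (h.isWeightedMultiplier 0).bounded, fun ⟨C, hC⟩ => ?_⟩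
    exact (hg.isWeightedMultiplier hf hC 0).isDruryArvesonMultiplier
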